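/- Let $s\ge 1$ and $n\ge 0$ be integers, $k=2s$, and let $\Gamma=(V,L)$ be the Cayley tree of order $k$ (the tree in which every vertex has exactly $k+1$ neighbours), with a fixed root $x^0$. Put $W_m=\{x: d(x,x^0)=m\}$ and $V_m=\{x: d(x,x^0)\le m\}$. Spins take values in $[0,1]$, equipped with Lebesgue measure. Let $J\neq 0$, $\beta>0$, and consider the Hamiltonian $$H(\sigma)=-J\sum_{\langle x,y\rangle\in L}\xi_{\sigma(x),\sigma(y)},\qquad \xi_{t,u}=\frac1{J\beta}\ln K(t,u),\qquad K(t,u)=1+\theta\sqrt[2n+1]{(t-\tfrac12)(u-\tfrac12)},$$ where $\sqrt[2n+1]{\cdot}$ is the real odd root. For $-4^{1/(2n+1)}<\theta<4^{1/(2n+1)}$ the kernel $K$ is positive on $[0,1]^2$; for $\theta=4^{1/(2n+1)}$ it vanishes exactly at $(t,u)=(0,1),(1,0)$, where one sets $\xi_{t,u}=0$. Given measurable functions $h_x:[0,1]\to\mathbb R$, $x\in V\setminus\{x^0\}$, a probability measure $\mu$ on $[0,1]^V$ is the splitting Gibbs measure corresponding to $(h_x)$ if for every $m\ge1$ its marginal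 on $[0,1]^{V_m}$ has, with respect to Lebesgue measure, the density $$\mu^{(m)}(\sigma)=Z_m^{-1}\exp\Big(-\beta H(\sigma)+\sum_{x\in W_m}h_x(\sigma(x))\Big),$$ where $H(\sigma)$ is the sum over the edges inside $V_m$ and $Z_m$ is the normalizing integral. A translation-invariant Gibbs measure is a splitting Gibbs measure corresponding to some $(h_x)$ with $h_x$ independent of $x\ne x^0$. Define $$\alpha_{2i}=\frac{2n+1}{2n+2i+1}\Big(\frac12\Big)^{\frac{2i}{2n+1}},\qquad \beta_{i}=\binom{2s}{i}\alpha_{i+1}\ (i\text{ odd}),\qquad \theta_{2i+1}=\frac{(2i+1)(2n+2i+3)\,4^{\frac1{2n+1}}}{(2s-2i)(2n+2i+1)},$$ $$T=\frac{\sum_{i=1}^{s}2^{\frac{2i-2}{2n+1}}\beta_{2i-1}\theta_{2i-1}+\alpha_{2s}2^{\frac{2s}{2n+1}}}{\sum_{i=1}^{s}2^{\frac{2i-2}{2n+1}}\beta_{2i-1}}.$$ Then: (a) if $-4^{1/(2n+1)}<\theta\le\theta_1$ and $\theta<4^{1/(2n+1)}$, there is exactly one translation-invariant Gibbs measure; (b)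 if $T\le\theta\le 4^{1/(2n+1)}$, there are exactly two translation-invariant Gibbs measures; (c) if $\theta_1<\theta<T$ and $\theta<4^{1/(2n+1)}$, there are exactly three translation-invariant Gibbs measures. -/

import Mathlib

open MeasureTheory

noncomputable section

/-- `G` is a Cayley tree of order `k`: a tree in which every vertex lies on exactly `k + 1` edges
(such a tree is infinite if `k ≥ 1`, and it is unique up to isomorphism). -/
def IsCayleyTree {V : Type*} (G : SimpleGraph V) [G.LocallyFinite] (k : ℕ) : Prop :=
  G.IsTree ∧ G.IsRegularOfDegree (k + 1)

theorem finite_dist_le {V : Type*} (G : SimpleGraph V) [G.LocallyFinite] (hG : G.Connected)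
    (x₀ : V) (n : ℕ) : {x : V | G.dist x₀ x ≤ n}.Finite := by
  induction n with
  | zero =>
    refine (Set.finite_singleton x₀).subset ?_
    intro x hx
    have h0 : G.dist x₀ x = 0 := Nat.le_zero.mp hx
    exact ((hG.dist_eq_zero_iff).mp h0).symm
  | succ n ih =>
    refine (ih.union (ih.biUnion (fun y _ => (G.neighborSet y).toFinite))).subset ?_
    intro x hx
    by_cases hle : G.dist x₀ x ≤ n
    · exact Or.inl hle
    · right
      have hd : G.dist x x₀ = n + 1 := by
        have h1 : G.dist x₀ x ≤ n + 1 := hx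
        rw [SimpleGraph.dist_comm]; omega
      obtain ⟨p, hp⟩ := hG.exists_walk_length_eq_dist x x₀
      cases p with
      | nil => simp at hd
      | @cons _ y _ hadj q =>
        rw [SimpleGraph.Walk.length_cons] at hp
        have hq : G.dist y x₀ ≤ n := le_trans (SimpleGraph.dist_le q) (by omega)
        refine Set.mem_biUnion (x := y) ?_ hadj.symm
        change G.dist x₀ y ≤ n
        rwa [SimpleGraph.dist_comm]

open Classical in
/-- The ball `V_n = {x | d(x₀, x) ≤ n}` as a finite set. It is always finite on a Cayley tree (see
`mem_treeBall`); the value `∅` is only used for graphs with infinite balls. -/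
def treeBall {V : Type*} (G : SimpleGraph V) (x₀ : V) (n : ℕ) : Finset V :=
  if hf : {x : V | G.dist x₀ x ≤ n}.Finite then hf.toFinset else ∅

theorem mem_treeBall {V : Type*} {G : SimpleGraph V} [G.LocallyFinite] {k : ℕ}
    (hG : IsCayleyTree G k) (x₀ : V) (n : ℕ) (x : V) :
    x ∈ treeBall G x₀ n ↔ G.dist x₀ x ≤ n := by
  have hf := finite_dist_le G hG.1.connected x₀ n
  simp [treeBall, hf]

/-- `y` is a direct successor of `x`, that is `y ∈ S(x)`: the vertices are neighbours and `y` is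
one step farther from the root `x₀`. -/
def IsSuccessor {V : Type*} (G : SimpleGraph V) (x₀ x y : V) : Prop :=
  G.Adj x y ∧ G.dist x₀ y = G.dist x₀ x + 1

open Classical in
/-- The Hamiltonian `H(σ) = -J ∑ ξ(σ(x), σ(y))` of a configuration `σ` on `V_n`; the sum runs over
the edges `⟨x, y⟩` of the tree with both end points in `V_n`. Each edge of a tree joins a vertex
`x` to one of its direct successors `y` in exactly one way, so each edge is counted once. -/
def hamiltonian {V : Type*} (G : SimpleGraph V) (x₀ : V) (J : ℝ)
    (ξ : unitInterval → unitInterval → ℝ) (n : ℕ)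
    (σ : treeBall G x₀ n → unitInterval) : ℝ :=
  -J * ∑ x : treeBall G x₀ n,
    ∑ y ∈ Finset.univ.filter (fun y : treeBall G x₀ n => IsSuccessor G x₀ (x : V) (y : V)),
      ξ (σ x) (σ y)

open Classical in
/-- The unnormalized density `exp(-β H(σ) + ∑_{x ∈ W_n} h_x(σ(x)))` on `[0,1]^{V_n}`, where `W_n`
is the sphere of radius `n`. -/
def gibbsWeight {V : Type*} (G : SimpleGraph V) (x₀ : V) (J β : ℝ)
    (ξ : unitInterval → unitInterval → ℝ)
    (h : V → unitInterval → ℝ) (n : ℕ) (σ : treeBall G x₀ n → unitInterval) : ℝ :=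
  Real.exp (-β * hamiltonian G x₀ J ξ n σ +
    ∑ x ∈ Finset.univ.filter (fun x : treeBall G x₀ n => G.dist x₀ (x : V) = n), h x (σ x))

/-- The partition function `Z_n`, an integral over `[0,1]^{V_n}` with its Lebesgue measure. -/
def partitionFunction {V : Type*} (G : SimpleGraph V) (x₀ : V) (J β : ℝ)
    (ξ : unitInterval → unitInterval → ℝ)
    (h : V → unitInterval → ℝ) (n : ℕ) : ℝ :=
  ∫ σ : treeBall G x₀ n → unitInterval, gibbsWeight G x₀ J β ξ h n σ

/-- The finite-volume distribution `μ^(n)` on `[0,1]^{V_n}`. (If the weight is not integrable this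
is the zero measure, which is not a marginal of a probability measure.) -/
def finiteVolumeGibbs {V : Type*} (G : SimpleGraph V) (x₀ : V) (J β : ℝ)
    (ξ : unitInterval → unitInterval → ℝ)
    (h : V → unitInterval → ℝ) (n : ℕ) : Measure (treeBall G x₀ n → unitInterval) :=
  volume.withDensity fun σ =>
    ENNReal.ofReal ((partitionFunction G x₀ J β ξ h n)⁻¹ * gibbsWeight G x₀ J β ξ h n σ)

/-- `μ` is the splitting Gibbs measure on `[0,1]^V` corresponding to the Hamiltonian and to the
function `x ↦ h_x`, `x ≠ x₀`: its marginal on every `V_n`, `n ≥ 1`, is `μ^(n)` (in particular the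
distributions `μ^(n)` are compatible). -/
def IsSplittingGibbsMeasure {V : Type*} (G : SimpleGraph V) (x₀ : V) (J β : ℝ)
    (ξ : unitInterval → unitInterval → ℝ)
    (h : V → unitInterval → ℝ) (μ : Measure (V → unitInterval)) : Prop :=
  IsProbabilityMeasure μ ∧ (∀ x, x ≠ x₀ → Measurable (h x)) ∧
    ∀ n : ℕ, 1 ≤ n → μ.map (treeBall G x₀ n).restrict = finiteVolumeGibbs G x₀ J β ξ h n

/-- `μ` is a translation-invariant (splitting) Gibbs measure: it corresponds to a function
`x ↦ h_x` that does not depend on the vertex `x ≠ x₀`. -/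
def IsTranslationInvariantGibbs {V : Type*} (G : SimpleGraph V) (x₀ : V) (J β : ℝ)
    (ξ : unitInterval → unitInterval → ℝ) (μ : Measure (V → unitInterval)) : Prop :=
  ∃ h : V → unitInterval → ℝ, (∀ x y, x ≠ x₀ → y ≠ x₀ → h x = h y) ∧
    IsSplittingGibbsMeasure G x₀ J β ξ h μ

/-- The real root of odd order `2n+1`, defined on all of `ℝ` (see `oddRoot_pow`). -/
def oddRoot (n : ℕ) (x : ℝ) : ℝ := Real.sign x * |x| ^ (1 / (2 * n + 1 : ℝ))

theorem oddRoot_pow (n : ℕ) (x : ℝ) : oddRoot n x ^ (2 * n + 1) = x := by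
  have hm : (2 * n + 1 : ℝ) ≠ 0 := by positivity
  have h1 : (|x| ^ (1 / (2 * n + 1 : ℝ))) ^ (2 * n + 1) = |x| := by
    rw [← Real.rpow_natCast, ← Real.rpow_mul (abs_nonneg x)]
    push_cast
    rw [one_div_mul_cancel hm, Real.rpow_one]
  rw [oddRoot, mul_pow, h1]
  rcases lt_trichotomy x 0 with hx | hx | hx
  · rw [Real.sign_of_neg hx, abs_of_neg hx, Odd.neg_one_pow ⟨n, rfl⟩]; ring
  · simp [hx]
  · rw [Real.sign_of_pos hx, abs_of_pos hx]; simp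

/-- The kernel `K(t,u) = 1 + θ ((t - 1/2)(u - 1/2))^{1/(2n+1)}`. -/
def kernelK (n : ℕ) (θ : ℝ) (t u : unitInterval) : ℝ :=
  1 + θ * oddRoot n (((t : ℝ) - 1 / 2) * ((u : ℝ) - 1 / 2))

/-- The interaction `ξ_{t,u} = (1/(Jβ)) ln K(t,u)`. -/
def interaction (n : ℕ) (J β θ : ℝ) (t u : unitInterval) : ℝ :=
  1 / (J * β) * Real.log (kernelK n θ t u)

/-- The critical range `4^{1/(2n+1)}` of the parameter. -/
def thetaMax (n : ℕ) : ℝ := (4 : ℝ) ^ (1 / (2 * n + 1 : ℝ))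

/-- `alphaEven n i` is `α_{2i}`. -/
def alphaEven (n i : ℕ) : ℝ :=
  (2 * n + 1) / (2 * n + 2 * i + 1) * (1 / 2 : ℝ) ^ (2 * i / (2 * n + 1) : ℝ)

/-- `betaOdd s n i` is `β_{2i+1} = C(2s, 2i+1) α_{2i+2}`. -/
def betaOdd (s n i : ℕ) : ℝ := ((2 * s).choose (2 * i + 1) : ℝ) * alphaEven n (i + 1)

/-- `thetaOdd s n i` is `θ_{2i+1}`, for `i < s`. -/
def thetaOdd (s n i : ℕ) : ℝ :=
  (2 * i + 1) * (2 * n + 2 * i + 3) * thetaMax n / ((2 * s - 2 * i) * (2 * n + 2 * i + 1))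

/-- The threshold separating the last two regimes. The index `i` here, `0 ≤ i < s`, stands for
`i - 1` in a sum over `1 ≤ i ≤ s` of terms in `β_{2i-1}` and `θ_{2i-1}`. -/
def threshold (s n : ℕ) : ℝ :=
  (∑ i ∈ Finset.range s, (2 : ℝ) ^ (2 * i / (2 * n + 1) : ℝ) * betaOdd s n i * thetaOdd s n i
      + alphaEven n s * (2 : ℝ) ^ (2 * s / (2 * n + 1) : ℝ)) /
    ∑ i ∈ Finset.range s, (2 : ℝ) ^ (2 * i / (2 * n + 1) : ℝ) * betaOdd s n i

end

/-!
Write `a(t) = (t - 1/2)^{1/(2n+1)}` (`centeredRoot`), so that `K(t,u) = 1 + θ a(t) a(u)`, and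
`k = 2s`.

*Reduction to one spin.* Let `h_x = h` for `x ≠ x⁰` and `F = exp h`. Each vertex of `W_{m+1}` has
exactly `k` successors, so integrating out `W_{m+2}` turns the weight on `V_{m+2}` into the weight
on `V_{m+1}` with `F` replaced by `(∫ K(·,u) F(u) du)^k`
(`IsCayleyTree.map_restrict_treeMeasure_succ`). The marginal on `V_1` determines the boundary factor
up to a constant, since the spins on `W_1` become independent after division by the edge factors
(`IsCayleyTree.ae_eq_of_map_treeMeasure`). Hence `F` belongs to a Gibbs measure exactly if it is
proportional to `(∫ K(·,u) F(u) du)^k`. Conversely, for such an `F` the finite-volume distributions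
are consistent, and a weak limit point of them, which exists as `[0,1]^V` is compact, is a Gibbs
measure (`IsCayleyTree.exists_isTreeGibbs`).

*The scalar equation.* For the kernel at hand `∫ K(·,u) F(u) du` is affine in `a`, so
`F ∝ (1 + c a)^k`, and the condition becomes
`θ ∫ a (1 + c a)^k = c ∫ (1 + c a)^k`. When `|θ| < 4^{1/(2n+1)}`, its solutions `c` automatically
satisfy `1 + c a > 0` and are in bijection with the translation-invariant Gibbs measures
(`IsCayleyTree.exists_injOn_image_eq`). The odd moments of `a` vanish and the even ones are the
`α_{2i}`; therefore `c = 0` is a solution, and the others are those with `p(c²) = 0` for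
`p(y) = ∑_{i<s} β_{2i+1} (θ_{2i+1} - θ) y^i + α_{2s} y^s` (`mul_powerMoment_sub`). As `θ_{2i+1}`
increases with `i`, the coefficients of `p` change their sign at most once. If `θ ≤ θ_1` there is no
positive root; if `θ_1 < θ < 4^{1/(2n+1)}` there is exactly one
(`existsUnique_boundaryPoly_root`), which gives `c = 0` and two opposite values.

*The case of two measures does not occur.* At `y = 4^{1/(2n+1)} = (1 / max a)²` and
`θ = 4^{1/(2n+1)}` the value of `p` is `∫ (1 - c a) (1 + c a)^k > 0` with `c = 1 / max a`, and this
inequality says that `T > 4^{1/(2n+1)}` (`thetaMax_lt_threshold`). So no `θ` satisfies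
`T ≤ θ ≤ 4^{1/(2n+1)}`, while the condition `θ < T` in the case of three measures always holds.
-/

noncomputable section

/-! ### Spheres and successors in a Cayley tree -/

open Classical in
/-- The sphere of radius `n` around the root, as a finite set. -/
def treeSphere {V : Type*} (G : SimpleGraph V) (x₀ : V) (n : ℕ) : Finset V :=
  (treeBall G x₀ n).filter fun x => G.dist x₀ x = n

open Classical in
/-- The set `S(x)` of direct successors of `x`, as a finite set. -/
def successors {V : Type*} (G : SimpleGraph V) [G.LocallyFinite] (x₀ x : V) : Finset V :=
  (G.neighborFinset x).filter fun y => IsSuccessor G x₀ x y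

theorem treeSphere_subset_treeBall {V : Type*} (G : SimpleGraph V) (x₀ : V) (n : ℕ) :
    treeSphere G x₀ n ⊆ treeBall G x₀ n :=
  Finset.filter_subset _ _

section Tree

variable {V : Type*} {G : SimpleGraph V} [G.LocallyFinite] {k : ℕ} {x₀ : V}

theorem mem_successors {x y : V} : y ∈ successors G x₀ x ↔ IsSuccessor G x₀ x y := by
  simp only [successors, Finset.mem_filter, SimpleGraph.mem_neighborFinset, and_iff_right_iff_imp]
  exact fun h => h.1

theorem IsCayleyTree.mem_treeSphere (hG : IsCayleyTree G k) {n : ℕ} {x : V} :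
    x ∈ treeSphere G x₀ n ↔ G.dist x₀ x = n := by
  simp only [treeSphere, Finset.mem_filter, mem_treeBall hG, and_iff_right_iff_imp]
  exact fun h => h.le

/-- Two predecessors of a vertex both come last but one on the unique path from the root. -/
theorem IsCayleyTree.predecessor_unique (hG : IsCayleyTree G k) {x x' y : V}
    (h : IsSuccessor G x₀ x y) (h' : IsSuccessor G x₀ x' y) : x = x' := by
  classical
  obtain ⟨p, hp, hpl⟩ := (hG.1.connected x₀ y).exists_path_of_dist
  have key : ∀ z, IsSuccessor G x₀ z y → z = p.penultimate := by
    intro z hz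
    refine hG.1.isAcyclic.eq_penultimate_of_adj_end hp hz.1.symm ?_
    obtain ⟨q, hq, hql⟩ := (hG.1.connected x₀ z).exists_path_of_dist
    refine hG.1.isAcyclic.mem_support_of_ne_mem_support_of_adj_of_isPath hp hq hz.1.symm ?_
    intro hy
    have h1 := SimpleGraph.dist_le (q.takeUntil y hy)
    have h2 := q.length_takeUntil_le_length hy
    have h3 := hz.2
    omega
  rw [key x h, key x' h']

theorem IsCayleyTree.exists_predecessor (hG : IsCayleyTree G k) {y : V} (hy : y ≠ x₀) :
    ∃ x, IsSuccessor G x₀ x y := by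
  obtain ⟨p, hp⟩ := (hG.1.connected y x₀).exists_walk_length_eq_dist
  cases p with
  | nil => exact absurd rfl hy
  | @cons _ x _ hadj q =>
    refine ⟨x, hadj.symm, ?_⟩
    rw [SimpleGraph.Walk.length_cons] at hp
    have h1 := SimpleGraph.dist_le q
    rw [SimpleGraph.dist_comm (u := x), SimpleGraph.dist_comm (u := y)] at *
    have h2 := hG.1.dist_eq_dist_add_one_of_adj x₀ hadj
    omega

theorem IsCayleyTree.card_successors (hG : IsCayleyTree G k) {x : V} (hx : x ≠ x₀) :
    (successors G x₀ x).card = k := by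
  classical
  obtain ⟨z, hz⟩ := hG.exists_predecessor hx
  have h : G.neighborFinset x = insert z (successors G x₀ x) := by
    ext y
    rw [SimpleGraph.mem_neighborFinset, Finset.mem_insert, mem_successors]
    constructor
    · intro hy
      rcases hG.1.dist_eq_dist_add_one_of_adj x₀ hy with h | h
      · exact Or.inl (hG.predecessor_unique ⟨hy.symm, h⟩ hz)
      · exact Or.inr ⟨hy, h⟩
    · rintro (rfl | h)
      · exact hz.1.symm
      · exact h.1
  have hz' : z ∉ successors G x₀ x := by
    rw [mem_successors]
    intro h
    have h1 := h.2
    have h2 := hz.2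
    omega
  have h1 := hG.2 x
  rw [← SimpleGraph.card_neighborFinset_eq_degree, h, Finset.card_insert_of_notMem hz'] at h1
  omega

theorem IsCayleyTree.ne_root (hG : IsCayleyTree G k) {n : ℕ} {x : V}
    (hx : x ∈ treeSphere G x₀ (n + 1)) : x ≠ x₀ := by
  rintro rfl
  simp [hG.mem_treeSphere] at hx

theorem IsCayleyTree.treeSphere_one_nonempty (hG : IsCayleyTree G k) :
    (treeSphere G x₀ 1).Nonempty := by
  have h : 0 < (G.neighborFinset x₀).card := by
    rw [SimpleGraph.card_neighborFinset_eq_degree, hG.2 x₀]; omega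
  obtain ⟨y, hy⟩ := Finset.card_pos.mp h
  rw [SimpleGraph.mem_neighborFinset] at hy
  exact ⟨y, hG.mem_treeSphere.2 (SimpleGraph.dist_eq_one_iff_adj.2 hy)⟩

theorem IsCayleyTree.pairwiseDisjoint_successors (hG : IsCayleyTree G k) (s : Set V) :
    s.PairwiseDisjoint (successors G x₀) := by
  intro x _ x' _ hne
  rw [Function.onFun, Finset.disjoint_left]
  intro y hy hy'
  exact hne (hG.predecessor_unique (mem_successors.1 hy) (mem_successors.1 hy'))

open Classical in
theorem IsCayleyTree.treeSphere_succ (hG : IsCayleyTree G k) (n : ℕ) :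
    treeSphere G x₀ (n + 1) = (treeSphere G x₀ n).biUnion (successors G x₀) := by
  ext y
  simp only [Finset.mem_biUnion, hG.mem_treeSphere, mem_successors]
  constructor
  · intro hy
    have hne : y ≠ x₀ := by rintro rfl; simp at hy
    obtain ⟨x, hx⟩ := hG.exists_predecessor hne
    exact ⟨x, by have := hx.2; omega, hx⟩
  · rintro ⟨x, hx, hxy⟩
    rw [hxy.2, hx]

open Classical in
theorem IsCayleyTree.treeBall_succ (hG : IsCayleyTree G k) (n : ℕ) :
    treeBall G x₀ (n + 1) = treeBall G x₀ n ∪ treeSphere G x₀ (n + 1) := by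
  ext y
  simp only [Finset.mem_union, hG.mem_treeSphere, mem_treeBall hG]
  omega

theorem IsCayleyTree.disjoint_treeBall_treeSphere (hG : IsCayleyTree G k) (n : ℕ) :
    Disjoint (treeBall G x₀ n) (treeSphere G x₀ (n + 1)) := by
  rw [Finset.disjoint_left]
  intro y
  simp only [hG.mem_treeSphere, mem_treeBall hG]
  omega

theorem IsCayleyTree.treeBall_mono (hG : IsCayleyTree G k) {m n : ℕ} (hmn : m ≤ n) :
    treeBall G x₀ m ⊆ treeBall G x₀ n := by
  intro y
  simp only [mem_treeBall hG]
  omega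

theorem IsCayleyTree.exists_subset_treeBall (hG : IsCayleyTree G k) (s : Finset V) :
    ∃ n, s ⊆ treeBall G x₀ n :=
  ⟨s.sup (G.dist x₀), fun x hx => (mem_treeBall hG x₀ _ x).2 (Finset.le_sup (f := G.dist x₀) hx)⟩

theorem IsCayleyTree.countable (hG : IsCayleyTree G k) : Countable V := by
  have x₀ : V := hG.1.connected.nonempty.some
  have h : (Set.univ : Set V) = ⋃ n, (treeBall G x₀ n : Set V) := by
    ext x
    simp only [Set.mem_univ, Set.mem_iUnion, Finset.mem_coe, true_iff]
    exact ⟨_, (mem_treeBall hG x₀ _ x).2 le_rfl⟩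
  rw [← Set.countable_univ_iff, h]
  exact Set.countable_iUnion fun n => Finset.countable_toSet _

end Tree

/-! ### Integration over one or several coordinates of an infinite product -/

section Product

open scoped ENNReal

variable {ι X : Type*} [MeasurableSpace X] (ν : Measure X) [IsProbabilityMeasure ν]

/-- Resampling the coordinate `i` independently of the others preserves a product measure. -/
theorem measurePreserving_update_infinitePi [DecidableEq ι] (i : ι) :
    MeasurePreserving (fun p : (ι → X) × X => Function.update p.1 i p.2)
      ((Measure.infinitePi fun _ => ν).prod ν) (Measure.infinitePi fun _ => ν) := by
  have hm : Measurable fun p : (ι → X) × X => Function.update p.1 i p.2 := by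
    refine measurable_pi_lambda _ fun j => ?_
    by_cases hj : j = i
    · subst hj; simpa using measurable_snd
    · simp only [Function.update_of_ne hj]; exact (measurable_pi_apply j).comp measurable_fst
  refine ⟨hm, Measure.eq_infinitePi _ fun s t ht => ?_⟩
  rw [Measure.map_apply hm (MeasurableSet.pi s.countable_toSet (fun j _ => ht j))]
  by_cases hi : i ∈ s
  · have : (fun p : (ι → X) × X => Function.update p.1 i p.2) ⁻¹' Set.pi s t
        = (Set.pi (s.erase i : Finset ι) t) ×ˢ t i := by
      ext p
      simp only [Set.mem_preimage, Set.mem_pi, Set.mem_prod, Finset.mem_coe, Finset.mem_erase]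
      constructor
      · refine fun h => ⟨fun j hj => ?_, ?_⟩
        · simpa [Function.update_of_ne hj.1] using h j hj.2
        · simpa using h i hi
      · rintro ⟨h1, h2⟩ j hj
        by_cases hji : j = i
        · subst hji; simpa using h2
        · simpa [Function.update_of_ne hji] using h1 j ⟨hji, hj⟩
    rw [this, Measure.prod_prod, Measure.infinitePi_pi _ (fun j _ => ht j),
      Finset.prod_erase_mul _ _ hi]
  · have : (fun p : (ι → X) × X => Function.update p.1 i p.2) ⁻¹' Set.pi s t
        = (Set.pi s t) ×ˢ Set.univ := by
      ext p
      simp only [Set.mem_preimage, Set.mem_pi, Set.mem_prod, Finset.mem_coe, Set.mem_univ, and_true]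
      refine forall₂_congr fun j hj => ?_
      rw [Function.update_of_ne (by rintro rfl; exact hi hj)]
    rw [this, Measure.prod_prod, Measure.infinitePi_pi _ (fun j _ => ht j), measure_univ, mul_one]

theorem lintegral_infinitePi_update [DecidableEq ι] (i : ι) {f : (ι → X) → ℝ≥0∞}
    (hf : Measurable f) :
    ∫⁻ ω, f ω ∂(Measure.infinitePi fun _ => ν)
      = ∫⁻ ω, ∫⁻ u, f (Function.update ω i u) ∂ν ∂(Measure.infinitePi fun _ => ν) := by
  have hp := measurePreserving_update_infinitePi ν i
  rw [← hp.lintegral_comp hf]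
  exact lintegral_prod _ (hf.comp hp.measurable).aemeasurable

/-- Each coordinate `ω y`, `y ∈ T`, occurs in the integrand only in the factor `q y`, whose first
argument `ω (p y)` is a coordinate outside `T`; it can be integrated out there. -/
theorem lintegral_mul_prod_infinitePi [DecidableEq ι] (T : Finset ι) (p : ι → ι)
    (hp : ∀ y ∈ T, p y ∉ T) (q : ι → X → X → ℝ≥0∞)
    (hq : ∀ y, Measurable (Function.uncurry (q y)))
    (A : (ι → X) → ℝ≥0∞) (hA : Measurable A)
    (hAT : ∀ y ∈ T, ∀ ω u, A (Function.update ω y u) = A ω) :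
    ∫⁻ ω, A ω * ∏ y ∈ T, q y (ω (p y)) (ω y) ∂(Measure.infinitePi fun _ => ν)
      = ∫⁻ ω, A ω * ∏ y ∈ T, ∫⁻ u, q y (ω (p y)) u ∂ν ∂(Measure.infinitePi fun _ => ν) := by
  have hqm : ∀ y, Measurable fun ω : ι → X => q y (ω (p y)) (ω y) := fun y =>
    (hq y).comp (f := fun ω : ι → X => (ω (p y), ω y))
      ((measurable_pi_apply (p y)).prodMk (measurable_pi_apply y))
  have hQm : ∀ y, Measurable fun ω : ι → X => ∫⁻ u, q y (ω (p y)) u ∂ν := fun y =>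
    (Measurable.lintegral_prod_right (hq y)).comp (measurable_pi_apply (p y))
  induction T using Finset.induction_on generalizing A with
  | empty => simp
  | insert y T hy ih =>
    have hpT : ∀ z ∈ T, p z ∉ T := fun z hz h =>
      hp z (Finset.mem_insert_of_mem hz) (Finset.mem_insert_of_mem h)
    have hne : ∀ z ∈ T, p z ≠ y := fun z hz h =>
      hp z (Finset.mem_insert_of_mem hz) (h ▸ Finset.mem_insert_self _ _)
    have hpy : p y ∉ insert y T := hp y (Finset.mem_insert_self _ _)
    rw [Finset.mem_insert, not_or] at hpy
    simp only [Finset.prod_insert hy]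
    rw [lintegral_infinitePi_update ν y (by fun_prop)]
    have h1 : ∀ ω : ι → X, ∫⁻ u, A (Function.update ω y u) *
          (q y (Function.update ω y u (p y)) (Function.update ω y u y) *
            ∏ z ∈ T, q z (Function.update ω y u (p z)) (Function.update ω y u z)) ∂ν
        = (A ω * ∫⁻ u, q y (ω (p y)) u ∂ν) * ∏ z ∈ T, q z (ω (p z)) (ω z) := by
      intro ω
      have h2 : ∀ u, A (Function.update ω y u) *
          (q y (Function.update ω y u (p y)) (Function.update ω y u y) *
            ∏ z ∈ T, q z (Function.update ω y u (p z)) (Function.update ω y u z))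
          = (A ω * ∏ z ∈ T, q z (ω (p z)) (ω z)) * q y (ω (p y)) u := by
        intro u
        rw [hAT y (Finset.mem_insert_self _ _), Function.update_self,
          Function.update_of_ne hpy.1]
        have : ∏ z ∈ T, q z (Function.update ω y u (p z)) (Function.update ω y u z)
            = ∏ z ∈ T, q z (ω (p z)) (ω z) := by
          refine Finset.prod_congr rfl fun z hz => ?_
          rw [Function.update_of_ne (hne z hz),
            Function.update_of_ne (by rintro rfl; exact hy hz)]
        rw [this]; ring
      simp only [h2]
      have h3 : Measurable fun u => q y (ω (p y)) u := (hq y).comp measurable_prodMk_left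
      rw [lintegral_const_mul _ h3]
      ring
    simp only [h1]
    rw [ih hpT (fun ω => A ω * ∫⁻ u, q y (ω (p y)) u ∂ν) (hA.mul (hQm y))]
    · simp only [mul_assoc]
    · intro z hz ω u
      rw [hAT z (Finset.mem_insert_of_mem hz),
        Function.update_of_ne (by rintro rfl; exact hpy.2 hz)]

theorem lintegral_prod_infinitePi [DecidableEq ι] (T : Finset ι) (q : ι → X → ℝ≥0∞)
    (hq : ∀ y, Measurable (q y)) :
    ∫⁻ ω, ∏ y ∈ T, q y (ω y) ∂(Measure.infinitePi fun _ => ν) = ∏ y ∈ T, ∫⁻ u, q y u ∂ν := by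
  induction T using Finset.induction_on with
  | empty => simp
  | insert y T hy ih =>
    simp only [Finset.prod_insert hy]
    rw [lintegral_infinitePi_update ν y (by fun_prop), ← ih,
      ← lintegral_const_mul _ (by fun_prop)]
    refine lintegral_congr fun ω => ?_
    rw [← lintegral_mul_const _ (hq y)]
    refine lintegral_congr fun u => ?_
    rw [Function.update_self]
    congr 1
    refine Finset.prod_congr rfl fun z hz => ?_
    rw [Function.update_of_ne (by rintro rfl; exact hy hz)]

theorem map_restrict_withDensity_infinitePi (s : Finset ι) {g : (s → X) → ℝ≥0∞}
    (hg : Measurable g) :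
    ((Measure.infinitePi fun _ : ι => ν).withDensity fun ω => g (s.restrict ω)).map s.restrict
      = (Measure.pi fun _ : s => ν).withDensity g := by
  ext t ht
  have hr : Measurable (s.restrict : (ι → X) → s → X) := Finset.measurable_restrict s
  rw [Measure.map_apply hr ht, withDensity_apply _ (hr ht), withDensity_apply _ ht,
    ← Measure.infinitePi_map_restrict (μ := fun _ : ι => ν), setLIntegral_map ht hg hr]

/-- A consistent sequence of probability measures on a product of compact spaces has an inverse
limit: any weak limit point of the sequence. Consistency means that the measures from the `n`-th on
agree on the coordinates in `s n`. -/
theorem exists_measure_map_restrict_eq [Countable ι] [TopologicalSpace X] [CompactSpace X]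
    [TopologicalSpace.MetrizableSpace X] [SecondCountableTopology X] [BorelSpace X]
    (s : ℕ → Finset ι) (P : ℕ → Measure (ι → X)) [∀ n, IsProbabilityMeasure (P n)]
    (hP : ∀ n m, n ≤ m → (P m).map (s n).restrict = (P n).map (s n).restrict) :
    ∃ μ : Measure (ι → X), IsProbabilityMeasure μ ∧
      ∀ n, μ.map (s n).restrict = (P n).map (s n).restrict := by
  let Q : ℕ → ProbabilityMeasure (ι → X) := fun n => ⟨P n, inferInstance⟩
  obtain ⟨μ, -, hμ⟩ := isCompact_univ.ultrafilter_le_nhds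
    ((Filter.hyperfilter ℕ).map Q) (by simp)
  refine ⟨μ, inferInstance, fun n => ?_⟩
  have hc : Continuous ((s n).restrict : (ι → X) → s n → X) :=
    continuous_pi fun j => continuous_apply (j : ι)
  have hlim : Filter.Tendsto (fun m => (Q m).map hc.aemeasurable) (Filter.hyperfilter ℕ)
      (nhds (μ.map hc.aemeasurable)) :=
    ProbabilityMeasure.tendsto_map_of_tendsto_of_continuous Q μ hμ hc
  have hev : (fun m => (Q m).map hc.aemeasurable) =ᶠ[Filter.hyperfilter ℕ]
      fun _ => (Q n).map hc.aemeasurable := by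
    have : ∀ᶠ m in Filter.hyperfilter ℕ, n ≤ m :=
      Nat.hyperfilter_le_atTop (Filter.eventually_ge_atTop n)
    filter_upwards [this] with m hm
    exact Subtype.ext (hP n m hm)
  have := tendsto_nhds_unique (hlim.congr' hev) tendsto_const_nhds
  exact congrArg Subtype.val this

end Product

/-! ### Weights on the balls of a Cayley tree -/

section Weights

open scoped ENNReal

variable {V X : Type*} (G : SimpleGraph V) [G.LocallyFinite] (x₀ : V)
  (K : X → X → ℝ≥0∞) (F : X → ℝ≥0∞)

/-- The product of `K` over the edges of the ball `V_{m+1}`; each of these joins a vertex of `V_m`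
to one of its direct successors. -/
def edgeWeight (m : ℕ) (ω : V → X) : ℝ≥0∞ :=
  ∏ x ∈ treeBall G x₀ m, ∏ y ∈ successors G x₀ x, K (ω x) (ω y)

/-- The weight on the ball `V_{m+1}` with edge factor `K` and with the factor `F` at each vertex
of its boundary `W_{m+1}`. The shift of the index excludes the ball `V_0`. -/
def treeWeight (m : ℕ) (ω : V → X) : ℝ≥0∞ :=
  edgeWeight G x₀ K m ω * ∏ y ∈ treeSphere G x₀ (m + 1), F (ω y)

variable {G x₀ K F} {k : ℕ}

theorem IsCayleyTree.prod_treeSphere_succ {M : Type*} [CommMonoid M] (hG : IsCayleyTree G k)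
    (m : ℕ) (g : V → M) :
    ∏ y ∈ treeSphere G x₀ (m + 1), g y
      = ∏ x ∈ treeSphere G x₀ m, ∏ y ∈ successors G x₀ x, g y := by
  classical
  rw [hG.treeSphere_succ, Finset.prod_biUnion (hG.pairwiseDisjoint_successors _)]

theorem IsCayleyTree.edgeWeight_succ (hG : IsCayleyTree G k) (m : ℕ) (ω : V → X) :
    edgeWeight G x₀ K (m + 1) ω = edgeWeight G x₀ K m ω *
      ∏ x ∈ treeSphere G x₀ (m + 1), ∏ y ∈ successors G x₀ x, K (ω x) (ω y) := by
  classical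
  rw [edgeWeight, hG.treeBall_succ, Finset.prod_union (hG.disjoint_treeBall_treeSphere m)]
  rfl

theorem IsCayleyTree.successor_mem_treeBall (hG : IsCayleyTree G k) {m : ℕ} {x y : V}
    (hx : x ∈ treeBall G x₀ m) (hy : y ∈ successors G x₀ x) : y ∈ treeBall G x₀ (m + 1) := by
  rw [mem_treeBall hG] at *
  rw [(mem_successors.1 hy).2]
  omega

theorem IsCayleyTree.edgeWeight_update [DecidableEq V] (hG : IsCayleyTree G k) {m : ℕ} {z : V}
    (hz : z ∉ treeBall G x₀ (m + 1)) (ω : V → X) (u : X) :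
    edgeWeight G x₀ K m (Function.update ω z u) = edgeWeight G x₀ K m ω := by
  refine Finset.prod_congr rfl fun x hx => Finset.prod_congr rfl fun y hy => ?_
  rw [Function.update_of_ne, Function.update_of_ne]
  · rintro rfl; exact hz (hG.successor_mem_treeBall hx hy)
  · rintro rfl; exact hz (hG.treeBall_mono (Nat.le_succ m) hx)

theorem exists_edgeWeight_ge {δ : ℝ≥0∞} (hδ : δ ≠ 0) (hKδ : ∀ s u, δ ≤ K s u) (m : ℕ) :
    ∃ C : ℝ≥0∞, C ≠ 0 ∧ ∀ ω : V → X, C ≤ edgeWeight G x₀ K m ω :=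
  ⟨∏ x ∈ treeBall G x₀ m, ∏ _y ∈ successors G x₀ x, δ,
    Finset.prod_ne_zero_iff.2 fun _ _ => Finset.prod_ne_zero_iff.2 fun _ _ => hδ,
    fun _ => Finset.prod_le_prod' fun _ _ => Finset.prod_le_prod' fun _ _ => hKδ _ _⟩

theorem exists_edgeWeight_le {M : ℝ≥0∞} (hM : M ≠ ∞) (hKM : ∀ s u, K s u ≤ M) (m : ℕ) :
    ∃ C : ℝ≥0∞, C ≠ ∞ ∧ ∀ ω : V → X, edgeWeight G x₀ K m ω ≤ C :=
  ⟨∏ x ∈ treeBall G x₀ m, ∏ _y ∈ successors G x₀ x, M,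
    ENNReal.prod_ne_top fun _ _ => ENNReal.prod_ne_top fun _ _ => hM,
    fun _ => Finset.prod_le_prod' fun _ _ => Finset.prod_le_prod' fun _ _ => hKM _ _⟩

variable (G x₀ K F) [MeasurableSpace X] (ν : Measure X)

/-- The measure on `X^V` whose density with respect to the product of the copies of `ν` is the
weight on `V_{m+1}`; only its marginal on `V_{m+1}` is of interest. -/
def treeMeasure (m : ℕ) : Measure (V → X) :=
  (Measure.infinitePi fun _ => ν).withDensity (treeWeight G x₀ K F m)

/-- The integral operator with kernel `K`, which integrates out a leaf of the tree. -/
def kernelIntegral (t : X) : ℝ≥0∞ := ∫⁻ u, K t u * F u ∂ν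

variable {G x₀ K F}

theorem measurable_edgeWeight (hK : Measurable (Function.uncurry K)) (m : ℕ) :
    Measurable (edgeWeight G x₀ K m) := by
  refine Finset.measurable_fun_prod _ fun x _ => Finset.measurable_fun_prod _ fun y _ => ?_
  exact hK.comp (f := fun ω : V → X => (ω x, ω y))
    ((measurable_pi_apply x).prodMk (measurable_pi_apply y))

theorem measurable_treeWeight (hK : Measurable (Function.uncurry K)) (hF : Measurable F) (m : ℕ) :
    Measurable (treeWeight G x₀ K F m) :=
  (measurable_edgeWeight hK m).mul
    (Finset.measurable_fun_prod _ fun y _ => hF.comp (measurable_pi_apply y))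

theorem measurable_kernelIntegral [SFinite ν] (hK : Measurable (Function.uncurry K))
    (hF : Measurable F) : Measurable (kernelIntegral K F ν) :=
  Measurable.lintegral_prod_right (hK.mul (hF.comp measurable_snd))

/-- The marginal on `V_{m+1}` of the weight on `V_{m+2}` is again of product form: each vertex of
`W_{m+1}` has `k` successors, and integrating out one of them gives a factor `kernelIntegral`. -/
theorem IsCayleyTree.map_restrict_treeMeasure_succ [IsProbabilityMeasure ν]
    (hG : IsCayleyTree G k) (hK : Measurable (Function.uncurry K)) (hF : Measurable F) (m : ℕ) :
    (treeMeasure G x₀ K F ν (m + 1)).map (treeBall G x₀ (m + 1)).restrict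
      = (treeMeasure G x₀ K (fun t => kernelIntegral K F ν t ^ k) ν m).map
          (treeBall G x₀ (m + 1)).restrict := by
  classical
  have hpar : ∀ y : V, ∃ x, y ≠ x₀ → IsSuccessor G x₀ x y := by
    intro y
    by_cases hy : y = x₀
    · exact ⟨x₀, fun h => absurd hy h⟩
    · obtain ⟨x, hx⟩ := hG.exists_predecessor hy
      exact ⟨x, fun _ => hx⟩
  choose par hpar using hpar
  have hpar' : ∀ {x y : V}, y ∈ successors G x₀ x → par y = x := by
    intro x y hy
    rw [mem_successors] at hy
    have hne : y ≠ x₀ := by rintro rfl; simpa using hy.2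
    exact hG.predecessor_unique (hpar y hne) hy
  have hI := measurable_kernelIntegral ν hK hF
  ext t ht
  have hr : Measurable ((treeBall G x₀ (m + 1)).restrict : (V → X) → _) :=
    Finset.measurable_restrict _
  have hS := hr ht
  set S : Set (V → X) := (treeBall G x₀ (m + 1)).restrict ⁻¹' t with hSdef
  rw [Measure.map_apply hr ht, Measure.map_apply hr ht, treeMeasure, treeMeasure,
    withDensity_apply _ hS, withDensity_apply _ hS, ← lintegral_indicator hS,
    ← lintegral_indicator hS]
  let A : (V → X) → ℝ≥0∞ := S.indicator (edgeWeight G x₀ K m)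
  let q : V → X → X → ℝ≥0∞ := fun _ s u => K s u * F u
  have h1 : ∀ ω, S.indicator (treeWeight G x₀ K F (m + 1)) ω
      = A ω * ∏ y ∈ treeSphere G x₀ (m + 1 + 1), q y (ω (par y)) (ω y) := by
    intro ω
    by_cases hω : ω ∈ S
    · simp only [A, Set.indicator_of_mem hω, treeWeight, hG.edgeWeight_succ, q,
        Finset.prod_mul_distrib, mul_assoc]
      congr 2
      rw [hG.prod_treeSphere_succ (m + 1)]
      refine Finset.prod_congr rfl fun x _ => Finset.prod_congr rfl fun y hy => ?_
      rw [hpar' hy]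
    · simp only [A, Set.indicator_of_notMem hω, zero_mul]
  have h2 : ∀ ω, S.indicator (treeWeight G x₀ K (fun t => kernelIntegral K F ν t ^ k) m) ω
      = A ω * ∏ y ∈ treeSphere G x₀ (m + 1 + 1), ∫⁻ u, q y (ω (par y)) u ∂ν := by
    intro ω
    by_cases hω : ω ∈ S
    · simp only [A, Set.indicator_of_mem hω, treeWeight]
      congr 1
      rw [hG.prod_treeSphere_succ (m + 1)]
      refine Finset.prod_congr rfl fun x hx => ?_
      rw [← hG.card_successors (hG.ne_root hx), ← Finset.prod_const]
      refine Finset.prod_congr rfl fun y hy => ?_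
      rw [hpar' hy]; rfl
    · simp only [A, Set.indicator_of_notMem hω, zero_mul]
  simp only [h1, h2]
  have hdisj : ∀ {y : V}, y ∈ treeSphere G x₀ (m + 1 + 1) → y ∉ treeBall G x₀ (m + 1) :=
    fun hy hy' => Finset.disjoint_left.1 (hG.disjoint_treeBall_treeSphere (m + 1)) hy' hy
  refine lintegral_mul_prod_infinitePi ν _ par ?_ q ?_ A ?_ ?_
  · intro y hy h
    have h3 := (hpar y (hG.ne_root hy)).2
    rw [hG.mem_treeSphere] at hy h
    omega
  · exact fun _ => hK.mul (hF.comp measurable_snd)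
  · exact (measurable_edgeWeight hK m).indicator hS
  · intro y hy ω u
    have hmem : Function.update ω y u ∈ S ↔ ω ∈ S := by
      have : (treeBall G x₀ (m + 1)).restrict (Function.update ω y u)
          = (treeBall G x₀ (m + 1)).restrict ω := by
        funext x
        exact Function.update_of_ne (fun h => hdisj hy (by rw [← h]; exact x.2)) _ _
      simp only [hSdef, Set.mem_preimage, this]
    by_cases hω : ω ∈ S
    · simp only [A, Set.indicator_of_mem hω, Set.indicator_of_mem (hmem.2 hω),
        hG.edgeWeight_update (hdisj hy)]
    · simp only [A, Set.indicator_of_notMem hω, Set.indicator_of_notMem (mt hmem.1 hω)]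

/-- A factor `F` that is rescaled, and changed on a null set, gives a rescaled measure. -/
theorem treeMeasure_congr [IsProbabilityMeasure ν] (hK : Measurable (Function.uncurry K))
    {F' : X → ℝ≥0∞} (hF' : Measurable F') {c : ℝ≥0∞} (h : F =ᵐ[ν] fun t => c * F' t) (m : ℕ) :
    treeMeasure G x₀ K F ν m
      = c ^ (treeSphere G x₀ (m + 1)).card • treeMeasure G x₀ K F' ν m := by
  rw [treeMeasure, treeMeasure, ← withDensity_smul _ (measurable_treeWeight hK hF' m)]
  refine withDensity_congr_ae ?_
  have h1 : ∀ᵐ ω ∂(Measure.infinitePi fun _ : V => ν), ∀ y ∈ treeSphere G x₀ (m + 1),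
      F (ω y) = c * F' (ω y) := by
    rw [Filter.eventually_all_finset]
    intro y _
    exact (measurePreserving_eval_infinitePi (fun _ : V => ν) y).quasiMeasurePreserving.ae h
  filter_upwards [h1] with ω hω
  rw [treeWeight, Finset.prod_congr rfl hω, Finset.prod_mul_distrib, Finset.prod_const,
    Pi.smul_apply, treeWeight, smul_eq_mul]
  ring

theorem lintegral_eq_of_map_restrict_eq {μ μ' : Measure (V → X)} {s : Finset V}
    (h : μ.map s.restrict = μ'.map s.restrict) {Φ : (V → X) → ℝ≥0∞} (hΦ : Measurable Φ)
    (hdep : DependsOn Φ (s : Set V)) : ∫⁻ ω, Φ ω ∂μ = ∫⁻ ω, Φ ω ∂μ' := by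
  classical
  rcases isEmpty_or_nonempty (V → X) with he | ⟨⟨x⟩⟩
  · rw [Measure.eq_zero_of_isEmpty μ, Measure.eq_zero_of_isEmpty μ']
  · let e : (s → X) → V → X := Function.updateFinset x s
    have he : Measurable e := measurable_updateFinset
    have hr : Measurable (s.restrict : (V → X) → s → X) := Finset.measurable_restrict s
    have h1 : ∀ ω, Φ ω = Φ (e (s.restrict ω)) := fun ω =>
      hdep fun i hi => by
        have hi' : i ∈ s := hi
        simp [e, Function.updateFinset, hi']
    rw [lintegral_congr (μ := μ) h1, lintegral_congr (μ := μ') h1]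
    have h2 := lintegral_map (μ := μ) (hΦ.comp he) hr
    rw [h] at h2
    exact h2.symm.trans (lintegral_map (μ := μ') (hΦ.comp he) hr)

section Mass

variable [IsProbabilityMeasure ν] (hF : Measurable F)
include hF

theorem exists_le_treeMeasure_univ {δ : ℝ≥0∞} (hδ : δ ≠ 0) (hKδ : ∀ s u, δ ≤ K s u) (m : ℕ) :
    ∃ C : ℝ≥0∞, C ≠ 0 ∧
      C * (∫⁻ u, F u ∂ν) ^ (treeSphere G x₀ (m + 1)).card ≤ treeMeasure G x₀ K F ν m Set.univ := by
  classical
  have hm : Measurable fun ω : V → X => ∏ y ∈ treeSphere G x₀ (m + 1), F (ω y) :=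
    Finset.measurable_fun_prod _ fun y _ => hF.comp (measurable_pi_apply y)
  obtain ⟨C, hC, hle⟩ := exists_edgeWeight_ge (G := G) (x₀ := x₀) hδ hKδ m
  refine ⟨C, hC, ?_⟩
  rw [treeMeasure, withDensity_apply _ MeasurableSet.univ, Measure.restrict_univ,
    ← Finset.prod_const, ← lintegral_prod_infinitePi ν _ _ fun _ => hF,
    ← lintegral_const_mul _ hm]
  exact lintegral_mono fun ω => mul_le_mul_left (hle ω) _

theorem treeMeasure_univ_ne_top {M : ℝ≥0∞} (hM : M ≠ ∞) (hKM : ∀ s u, K s u ≤ M)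
    (hFi : ∫⁻ u, F u ∂ν ≠ ∞) (m : ℕ) : treeMeasure G x₀ K F ν m Set.univ ≠ ∞ := by
  classical
  have hm : Measurable fun ω : V → X => ∏ y ∈ treeSphere G x₀ (m + 1), F (ω y) :=
    Finset.measurable_fun_prod _ fun y _ => hF.comp (measurable_pi_apply y)
  obtain ⟨C, hC, hle⟩ := exists_edgeWeight_le (G := G) (x₀ := x₀) hM hKM m
  have : treeMeasure G x₀ K F ν m Set.univ
      ≤ C * (∫⁻ u, F u ∂ν) ^ (treeSphere G x₀ (m + 1)).card := by
    rw [treeMeasure, withDensity_apply _ MeasurableSet.univ, Measure.restrict_univ,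
      ← Finset.prod_const, ← lintegral_prod_infinitePi ν _ _ fun _ => hF,
      ← lintegral_const_mul _ hm]
    exact lintegral_mono fun ω => mul_le_mul_left (hle ω) _
  exact ne_top_of_le_ne_top (ENNReal.mul_ne_top hC (ENNReal.pow_ne_top hFi)) this

end Mass

/-- Dividing by the edge factors makes the spins on `W_1` independent. -/
theorem lintegral_treeMeasure_zero [IsProbabilityMeasure ν]
    (hK : Measurable (Function.uncurry K)) (hF : Measurable F)
    (hK0 : ∀ s u, K s u ≠ 0) (hK1 : ∀ s u, K s u ≠ ∞) {φ : X → ℝ≥0∞} (hφ : Measurable φ) {y : V}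
    (hy : y ∈ treeSphere G x₀ 1) :
    ∫⁻ ω, φ (ω y) * (edgeWeight G x₀ K 0 ω)⁻¹ ∂(treeMeasure G x₀ K F ν 0)
      = (∫⁻ u, φ u * F u ∂ν) * (∫⁻ u, F u ∂ν) ^ ((treeSphere G x₀ 1).card - 1) := by
  classical
  have hm : Measurable fun ω : V → X => φ (ω y) * (edgeWeight G x₀ K 0 ω)⁻¹ :=
    (hφ.comp (measurable_pi_apply y)).mul (measurable_edgeWeight hK 0).inv
  let q : V → X → ℝ≥0∞ := fun z => if z = y then fun u => φ u * F u else F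
  have hq : ∀ z, Measurable (q z) := by
    intro z
    by_cases hz : z = y
    · simp only [q, hz, if_true]; exact hφ.mul hF
    · simp only [q, hz, if_false]; exact hF
  have hrest : ∀ z ∈ (treeSphere G x₀ 1).erase y, q z = F := fun z hz => by
    simp [q, Finset.ne_of_mem_erase hz]
  have hqy : q y = fun u => φ u * F u := by simp [q]
  rw [treeMeasure, lintegral_withDensity_eq_lintegral_mul _ (measurable_treeWeight hK hF 0) hm]
  have h1 : ∀ ω : V → X, (treeWeight G x₀ K F 0 * fun ω => φ (ω y) * (edgeWeight G x₀ K 0 ω)⁻¹) ω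
      = ∏ z ∈ treeSphere G x₀ 1, q z (ω z) := by
    intro ω
    have h0 : edgeWeight G x₀ K 0 ω ≠ 0 :=
      Finset.prod_ne_zero_iff.2 fun _ _ => Finset.prod_ne_zero_iff.2 fun _ _ => hK0 _ _
    have h1 : edgeWeight G x₀ K 0 ω ≠ ∞ :=
      ENNReal.prod_ne_top fun _ _ => ENNReal.prod_ne_top fun _ _ => hK1 _ _
    have h2 : ∏ z ∈ (treeSphere G x₀ 1).erase y, q z (ω z)
        = ∏ z ∈ (treeSphere G x₀ 1).erase y, F (ω z) :=
      Finset.prod_congr rfl fun z hz => by rw [hrest z hz]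
    rw [Pi.mul_apply, treeWeight, zero_add, ← Finset.mul_prod_erase _ (fun z => F (ω z)) hy,
      ← Finset.mul_prod_erase _ (fun z => q z (ω z)) hy, h2, hqy]
    calc _ = (edgeWeight G x₀ K 0 ω * (edgeWeight G x₀ K 0 ω)⁻¹) * (φ (ω y) * F (ω y) *
          ∏ z ∈ (treeSphere G x₀ 1).erase y, F (ω z)) := by ring
      _ = _ := by rw [ENNReal.mul_inv_cancel h0 h1, one_mul]
  have h2 : ∏ z ∈ (treeSphere G x₀ 1).erase y, ∫⁻ u, q z u ∂ν
      = ∏ _z ∈ (treeSphere G x₀ 1).erase y, ∫⁻ u, F u ∂ν :=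
    Finset.prod_congr rfl fun z hz => by rw [hrest z hz]
  rw [lintegral_congr h1, lintegral_prod_infinitePi ν _ q hq,
    ← Finset.mul_prod_erase _ (fun z => ∫⁻ u, q z u ∂ν) hy, h2, hqy, Finset.prod_const,
    Finset.card_erase_of_mem hy]

/-- The marginal on `V_1` determines the boundary factor up to a constant. -/
theorem IsCayleyTree.ae_eq_of_map_treeMeasure [IsProbabilityMeasure ν] (hG : IsCayleyTree G k)
    (hK : Measurable (Function.uncurry K)) (hK0 : ∀ s u, K s u ≠ 0) (hK1 : ∀ s u, K s u ≠ ∞)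
    (hF : Measurable F) {F' : X → ℝ≥0∞} (hF' : Measurable F')
    (hFi : ∫⁻ u, F u ∂ν ≠ ∞) (hF0 : ∫⁻ u, F u ∂ν ≠ 0)
    (hFi' : ∫⁻ u, F' u ∂ν ≠ ∞) (hF0' : ∫⁻ u, F' u ∂ν ≠ 0)
    {c c' : ℝ≥0∞} (hc0 : c ≠ 0) (hc : c ≠ ∞) (hc0' : c' ≠ 0) (hc' : c' ≠ ∞)
    (h : c • (treeMeasure G x₀ K F ν 0).map (treeBall G x₀ 1).restrict
      = c' • (treeMeasure G x₀ K F' ν 0).map (treeBall G x₀ 1).restrict) :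
    ∃ a : ℝ≥0∞, a ≠ 0 ∧ a ≠ ∞ ∧ F =ᵐ[ν] fun t => a * F' t := by
  classical
  obtain ⟨y, hy⟩ := hG.treeSphere_one_nonempty (x₀ := x₀)
  set N := (treeSphere G x₀ 1).card - 1 with hN
  set b := c * (∫⁻ u, F u ∂ν) ^ N with hb
  set b' := c' * (∫⁻ u, F' u ∂ν) ^ N with hb'
  have hb0 : b ≠ 0 := mul_ne_zero hc0 (pow_ne_zero _ hF0)
  have hbt : b ≠ ∞ := ENNReal.mul_ne_top hc (ENNReal.pow_ne_top hFi)
  have hb0' : b' ≠ 0 := mul_ne_zero hc0' (pow_ne_zero _ hF0')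
  have hbt' : b' ≠ ∞ := ENNReal.mul_ne_top hc' (ENNReal.pow_ne_top hFi')
  have hr : Measurable ((treeBall G x₀ 1).restrict : (V → X) → treeBall G x₀ 1 → X) :=
    Finset.measurable_restrict _
  rw [← Measure.map_smul, ← Measure.map_smul] at h
  have key : ∀ φ : X → ℝ≥0∞, Measurable φ → b * ∫⁻ u, φ u * F u ∂ν = b' * ∫⁻ u, φ u * F' u ∂ν := by
    intro φ hφ
    have hm : Measurable fun ω : V → X => φ (ω y) * (edgeWeight G x₀ K 0 ω)⁻¹ :=
      (hφ.comp (measurable_pi_apply y)).mul (measurable_edgeWeight hK 0).inv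
    have hdep : DependsOn (fun ω : V → X => φ (ω y) * (edgeWeight G x₀ K 0 ω)⁻¹)
        (treeBall G x₀ 1 : Set V) := by
      intro ω ω' hω
      have h1 : ω y = ω' y := hω y (treeSphere_subset_treeBall G x₀ 1 hy)
      have h2 : edgeWeight G x₀ K 0 ω = edgeWeight G x₀ K 0 ω' := by
        refine Finset.prod_congr rfl fun x hx => Finset.prod_congr rfl fun z hz => ?_
        rw [hω x (hG.treeBall_mono (Nat.le_succ 0) hx), hω z (hG.successor_mem_treeBall hx hz)]
      simp only [h1, h2]
    have h3 := lintegral_eq_of_map_restrict_eq h hm hdep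
    rw [lintegral_smul_measure, lintegral_smul_measure,
      lintegral_treeMeasure_zero ν hK hF hK0 hK1 hφ hy,
      lintegral_treeMeasure_zero ν hK hF' hK0 hK1 hφ hy, smul_eq_mul, smul_eq_mul] at h3
    rw [hb, hb']
    calc _ = c * ((∫⁻ u, φ u * F u ∂ν) * (∫⁻ u, F u ∂ν) ^ N) := by ring
      _ = _ := by rw [h3]; ring
  refine ⟨b⁻¹ * b', mul_ne_zero (ENNReal.inv_ne_zero.2 hbt) hb0',
    ENNReal.mul_ne_top (ENNReal.inv_ne_top.2 hb0) hbt', ?_⟩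
  refine ae_eq_of_forall_setLIntegral_eq_of_sigmaFinite hF (hF'.const_mul _) fun s hs _ => ?_
  have h4 := key (s.indicator 1) (measurable_one.indicator hs)
  have h5 : ∀ g : X → ℝ≥0∞, ∫⁻ u, s.indicator 1 u * g u ∂ν = ∫⁻ u in s, g u ∂ν := by
    intro g
    rw [← lintegral_indicator hs]
    refine lintegral_congr fun u => ?_
    by_cases hu : u ∈ s <;> simp [hu]
  rw [h5, h5] at h4
  rw [lintegral_const_mul _ hF', mul_assoc, ← h4, ← mul_assoc, ENNReal.inv_mul_cancel hb0 hbt,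
    one_mul]

end Weights

/-! ### Measures with prescribed marginals on the balls -/

section TreeGibbs

open scoped ENNReal

variable {V X : Type*} (G : SimpleGraph V) [G.LocallyFinite] (x₀ : V)
  (K : X → X → ℝ≥0∞) (F : X → ℝ≥0∞) [MeasurableSpace X] (ν : Measure X)

/-- `μ` is a probability measure whose marginal on each ball `V_{m+1}` has a density proportional to
the weight with edge factor `K` and boundary factor `F`. -/
def IsTreeGibbs (μ : Measure (V → X)) : Prop :=
  IsProbabilityMeasure μ ∧ ∀ m, ∃ c : ℝ≥0∞, μ.map (treeBall G x₀ (m + 1)).restrict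
    = c • (treeMeasure G x₀ K F ν m).map (treeBall G x₀ (m + 1)).restrict

variable {G x₀ K F ν} {k : ℕ}

theorem mul_univ_eq_one_of_map_restrict {μ η : Measure (V → X)} [IsProbabilityMeasure μ]
    {s : Finset V} {c : ℝ≥0∞} (h : μ.map s.restrict = c • η.map s.restrict) :
    c * η Set.univ = 1 := by
  have hr : Measurable (s.restrict : (V → X) → s → X) := Finset.measurable_restrict s
  have h1 := congrArg (fun m => m Set.univ) h
  simp only [Measure.smul_apply, smul_eq_mul] at h1
  rw [Measure.map_apply hr MeasurableSet.univ, Measure.map_apply hr MeasurableSet.univ,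
    Set.preimage_univ, measure_univ] at h1
  exact h1.symm

theorem ne_zero_of_mul_eq_one {c d : ℝ≥0∞} (h : c * d = 1) : c ≠ 0 := by
  rintro rfl; simp at h

theorem ne_top_of_mul_eq_one {c d : ℝ≥0∞} (h : c * d = 1) : c ≠ ∞ := by
  rintro rfl
  have : d ≠ 0 := by rintro rfl; simp at h
  simp [ENNReal.top_mul this] at h

theorem map_restrict_of_subset {μ η : Measure (V → X)} {s t : Finset V} (hst : s ⊆ t)
    (h : μ.map t.restrict = η.map t.restrict) : μ.map s.restrict = η.map s.restrict := by
  have hr : Measurable (t.restrict : (V → X) → t → X) := Finset.measurable_restrict t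
  have hr₂ : Measurable (Finset.restrict₂ (π := fun _ => X) hst) := Finset.measurable_restrict₂ hst
  have h1 : (s.restrict : (V → X) → s → X) = Finset.restrict₂ hst ∘ t.restrict := rfl
  rw [h1, ← Measure.map_map hr₂ hr, ← Measure.map_map hr₂ hr, h]

/-- Every finite set of vertices lies in a ball, so the marginals on balls determine a measure. -/
theorem IsCayleyTree.measure_ext (hG : IsCayleyTree G k) {μ μ' : Measure (V → X)}
    [IsFiniteMeasure μ'] (h : ∀ m, μ.map (treeBall G x₀ (m + 1)).restrict
      = μ'.map (treeBall G x₀ (m + 1)).restrict) : μ = μ' := by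
  have hfin : ∀ s : Finset V, IsFiniteMeasure (μ'.map s.restrict) := fun s => inferInstance
  refine IsProjectiveLimit.unique (P := fun s => μ'.map s.restrict) (fun s => ?_) fun s => rfl
  obtain ⟨n, hn⟩ := hG.exists_subset_treeBall (x₀ := x₀) s
  exact map_restrict_of_subset (hn.trans (hG.treeBall_mono (Nat.le_succ n))) (h n)

theorem IsCayleyTree.isTreeGibbs_unique (hG : IsCayleyTree G k) {μ μ' : Measure (V → X)}
    (h : IsTreeGibbs G x₀ K F ν μ) (h' : IsTreeGibbs G x₀ K F ν μ') : μ = μ' := by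
  have := h.1
  have := h'.1
  refine hG.measure_ext (x₀ := x₀) fun m => ?_
  obtain ⟨c, hc⟩ := h.2 m
  obtain ⟨c', hc'⟩ := h'.2 m
  have h1 := mul_univ_eq_one_of_map_restrict hc
  have h2 := mul_univ_eq_one_of_map_restrict hc'
  rw [hc, hc', ENNReal.eq_inv_of_mul_eq_one_left h1, ENNReal.eq_inv_of_mul_eq_one_left h2]

theorem IsTreeGibbs.congr [IsProbabilityMeasure ν] (hK : Measurable (Function.uncurry K))
    {F' : X → ℝ≥0∞} (hF' : Measurable F') {a : ℝ≥0∞} (h : F =ᵐ[ν] fun t => a * F' t)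
    {μ : Measure (V → X)} (hμ : IsTreeGibbs G x₀ K F ν μ) : IsTreeGibbs G x₀ K F' ν μ := by
  refine ⟨hμ.1, fun m => ?_⟩
  obtain ⟨c, hc⟩ := hμ.2 m
  exact ⟨c * a ^ (treeSphere G x₀ (m + 1)).card, by
    rw [hc, treeMeasure_congr ν hK hF' h, Measure.map_smul, smul_smul]⟩

/-- If the boundary factor `F` is reproduced, up to a constant, when the outermost sphere is
integrated out, then the weights on the balls are consistent. -/
theorem IsCayleyTree.exists_isTreeGibbs [IsProbabilityMeasure ν] [TopologicalSpace X]
    [CompactSpace X] [TopologicalSpace.MetrizableSpace X] [SecondCountableTopology X]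
    [BorelSpace X] (hG : IsCayleyTree G k) (hK : Measurable (Function.uncurry K))
    (hF : Measurable F) {a : ℝ≥0∞}
    (hfix : (fun t => kernelIntegral K F ν t ^ k) =ᵐ[ν] fun t => a * F t)
    (h0 : ∀ m, treeMeasure G x₀ K F ν m Set.univ ≠ 0)
    (hfin : ∀ m, treeMeasure G x₀ K F ν m Set.univ ≠ ∞) :
    ∃ μ, IsTreeGibbs G x₀ K F ν μ := by
  have := hG.countable
  let P : ℕ → Measure (V → X) := fun m =>
    (treeMeasure G x₀ K F ν m Set.univ)⁻¹ • treeMeasure G x₀ K F ν m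
  have hP : ∀ m, IsProbabilityMeasure (P m) := fun m =>
    ⟨by simp [P, ENNReal.inv_mul_cancel (h0 m) (hfin m)]⟩
  have hstep : ∀ m, (P (m + 1)).map (treeBall G x₀ (m + 1)).restrict
      = (P m).map (treeBall G x₀ (m + 1)).restrict := by
    intro m
    have h1 := hG.map_restrict_treeMeasure_succ ν hK hF m (x₀ := x₀)
    rw [treeMeasure_congr ν hK hF hfix, Measure.map_smul] at h1
    have h2 : (P (m + 1)).map (treeBall G x₀ (m + 1)).restrict =
        ((treeMeasure G x₀ K F ν (m + 1) Set.univ)⁻¹ *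
          a ^ (treeSphere G x₀ (m + 1)).card) •
          (treeMeasure G x₀ K F ν m).map (treeBall G x₀ (m + 1)).restrict := by
      rw [Measure.map_smul, h1, smul_smul]
    rw [h2, Measure.map_smul,
      ENNReal.eq_inv_of_mul_eq_one_left (mul_univ_eq_one_of_map_restrict h2)]
  have hcons : ∀ n m, n ≤ m → (P m).map (treeBall G x₀ (n + 1)).restrict
      = (P n).map (treeBall G x₀ (n + 1)).restrict := by
    intro n m hnm
    induction m, hnm using Nat.le_induction with
    | base => rfl
    | succ m hnm ih =>
      rw [← ih]
      exact map_restrict_of_subset (hG.treeBall_mono (by omega)) (hstep m)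
  obtain ⟨μ, hμ, hμP⟩ := exists_measure_map_restrict_eq (fun n => treeBall G x₀ (n + 1)) P hcons
  exact ⟨μ, hμ, fun m => ⟨_, by rw [hμP m, Measure.map_smul]⟩⟩

section Rigidity

variable [IsProbabilityMeasure ν] {δ M : ℝ≥0∞} {μ : Measure (V → X)}

theorem IsTreeGibbs.lintegral_ne_top (hG : IsCayleyTree G k) (hF : Measurable F) (hδ : δ ≠ 0)
    (hKδ : ∀ s u, δ ≤ K s u) (hμ : IsTreeGibbs G x₀ K F ν μ) : ∫⁻ u, F u ∂ν ≠ ∞ := by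
  have := hμ.1
  obtain ⟨c, hc⟩ := hμ.2 0
  have h1 := mul_univ_eq_one_of_map_restrict hc
  obtain ⟨C, hC, hle⟩ := exists_le_treeMeasure_univ (G := G) (x₀ := x₀) ν hF hδ hKδ 0
  intro htop
  have hcard : (treeSphere G x₀ (0 + 1)).card ≠ 0 :=
    (Finset.card_pos.2 hG.treeSphere_one_nonempty).ne'
  rw [htop, ENNReal.top_pow hcard, ENNReal.mul_top hC, top_le_iff] at hle
  rw [mul_comm] at h1
  exact ne_top_of_mul_eq_one h1 hle

theorem lintegral_ne_zero_of_forall_ne_zero (hF : Measurable F) (hF0 : ∀ u, F u ≠ 0) :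
    ∫⁻ u, F u ∂ν ≠ 0 := by
  rw [Ne, lintegral_eq_zero_iff hF]
  intro h
  obtain ⟨u, hu⟩ := h.exists
  exact hF0 u hu

variable (hG : IsCayleyTree G k) (hK : Measurable (Function.uncurry K)) (hδ : δ ≠ 0) (hM : M ≠ ∞)
  (hKδ : ∀ s u, δ ≤ K s u) (hKM : ∀ s u, K s u ≤ M)
include hG hK hδ hM hKδ hKM

theorem IsTreeGibbs.ae_eq_const_mul (hF : Measurable F) (hF0 : ∀ u, F u ≠ 0) {F' : X → ℝ≥0∞}
    (hF' : Measurable F') (hF0' : ∀ u, F' u ≠ 0) (hμ : IsTreeGibbs G x₀ K F ν μ)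
    (hμ' : IsTreeGibbs G x₀ K F' ν μ) :
    ∃ a : ℝ≥0∞, a ≠ 0 ∧ a ≠ ∞ ∧ F =ᵐ[ν] fun t => a * F' t := by
  have := hμ.1
  obtain ⟨c, hc⟩ := hμ.2 0
  obtain ⟨c', hc'⟩ := hμ'.2 0
  have h1 := mul_univ_eq_one_of_map_restrict hc
  have h1' := mul_univ_eq_one_of_map_restrict hc'
  exact hG.ae_eq_of_map_treeMeasure ν hK (fun s u h => hδ (by simpa [h] using hKδ s u))
    (fun s u => ne_top_of_le_ne_top hM (hKM s u)) hF hF'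
    (hμ.lintegral_ne_top hG hF hδ hKδ) (lintegral_ne_zero_of_forall_ne_zero hF hF0)
    (hμ'.lintegral_ne_top hG hF' hδ hKδ) (lintegral_ne_zero_of_forall_ne_zero hF' hF0')
    (ne_zero_of_mul_eq_one h1) (ne_top_of_mul_eq_one h1) (ne_zero_of_mul_eq_one h1')
    (ne_top_of_mul_eq_one h1') (hc.symm.trans hc')

/-- The marginal on `V_1` of the weight on `V_2` has the boundary factor `(∫ K(·, u) F(u) du)^k`;
as it is also the weight on `V_1`, the two boundary factors are proportional. -/
theorem IsTreeGibbs.ae_eq_kernelIntegral_pow (hF : Measurable F) (hF0 : ∀ u, F u ≠ 0)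
    (hμ : IsTreeGibbs G x₀ K F ν μ) :
    ∃ a : ℝ≥0∞, a ≠ 0 ∧ a ≠ ∞ ∧ F =ᵐ[ν] fun t => a * kernelIntegral K F ν t ^ k := by
  have := hμ.1
  obtain ⟨c, hc⟩ := hμ.2 0
  obtain ⟨c', hc'⟩ := hμ.2 1
  have h1 := mul_univ_eq_one_of_map_restrict hc
  have h1' := mul_univ_eq_one_of_map_restrict hc'
  have hFi := hμ.lintegral_ne_top hG hF hδ hKδ
  have hFz : ∫⁻ u, F u ∂ν ≠ 0 := lintegral_ne_zero_of_forall_ne_zero hF hF0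
  have hlow : ∀ t, δ * ∫⁻ u, F u ∂ν ≤ kernelIntegral K F ν t := fun t => by
    rw [← lintegral_const_mul _ hF]
    exact lintegral_mono fun u => mul_le_mul_left (hKδ t u) _
  have hupp : ∀ t, kernelIntegral K F ν t ≤ M * ∫⁻ u, F u ∂ν := fun t => by
    rw [← lintegral_const_mul _ hF]
    exact lintegral_mono fun u => mul_le_mul_left (hKM t u) _
  have hpos : ∀ t, kernelIntegral K F ν t ^ k ≠ 0 := fun t =>
    pow_ne_zero _ fun h => mul_ne_zero hδ hFz (le_zero_iff.1 (h ▸ hlow t))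
  have hIm := (measurable_kernelIntegral ν hK hF).pow_const k
  have hIfin : ∫⁻ t, kernelIntegral K F ν t ^ k ∂ν ≠ ∞ := by
    refine ne_top_of_le_ne_top (ENNReal.pow_ne_top (ENNReal.mul_ne_top hM hFi) (n := k)) ?_
    calc ∫⁻ t, kernelIntegral K F ν t ^ k ∂ν ≤ ∫⁻ _, (M * ∫⁻ u, F u ∂ν) ^ k ∂ν :=
          lintegral_mono fun t => pow_le_pow_left₀ (zero_le) (hupp t) k
      _ = _ := by simp
  refine hG.ae_eq_of_map_treeMeasure ν hK (fun s u h => hδ (by simpa [h] using hKδ s u))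
    (fun s u => ne_top_of_le_ne_top hM (hKM s u)) hF hIm hFi hFz hIfin
    (lintegral_ne_zero_of_forall_ne_zero hIm hpos) (ne_zero_of_mul_eq_one h1)
    (ne_top_of_mul_eq_one h1)
    (ne_zero_of_mul_eq_one h1') (ne_top_of_mul_eq_one h1') ?_ (x₀ := x₀)
  rw [← Measure.map_smul] at hc'
  have h3 := map_restrict_of_subset (hG.treeBall_mono (x₀ := x₀) (show 1 ≤ 1 + 1 by omega)) hc'
  rw [Measure.map_smul] at h3
  rw [← hG.map_restrict_treeMeasure_succ ν hK hF 0]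
  exact hc.symm.trans h3

end Rigidity

end TreeGibbs

/-! ### The odd root and the positivity of the kernel -/

section Root

/-- The function `t ↦ (t - 1/2)^{1/(2n+1)}` in terms of which `K(t,u) = 1 + θ a(t) a(u)`. -/
def centeredRoot (n : ℕ) (t : unitInterval) : ℝ := oddRoot n ((t : ℝ) - 1 / 2)

/-- The maximum `(1/2)^{1/(2n+1)}` of `centeredRoot n`. -/
def rootMax (n : ℕ) : ℝ := (1 / 2 : ℝ) ^ (1 / (2 * n + 1 : ℝ))

variable (n : ℕ)

theorem oddRoot_mul (x y : ℝ) : oddRoot n (x * y) = oddRoot n x * oddRoot n y := by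
  have hs : Real.sign (x * y) = Real.sign x * Real.sign y := by
    rcases lt_trichotomy x 0 with hx | hx | hx <;> rcases lt_trichotomy y 0 with hy | hy | hy <;>
      simp [Real.sign_of_neg, Real.sign_of_pos, mul_pos_of_neg_of_neg, mul_neg_of_neg_of_pos,
        mul_neg_of_pos_of_neg, hx, hy]
  rw [oddRoot, oddRoot, oddRoot, hs, abs_mul, Real.mul_rpow (abs_nonneg x) (abs_nonneg y)]
  ring

theorem oddRoot_neg (x : ℝ) : oddRoot n (-x) = -oddRoot n x := by
  rw [oddRoot, oddRoot, Real.sign_neg, abs_neg]; ring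

theorem abs_oddRoot (x : ℝ) : |oddRoot n x| = |x| ^ (1 / (2 * n + 1 : ℝ)) := by
  have hp : (0 : ℝ) < 1 / (2 * n + 1 : ℝ) := by positivity
  rcases lt_trichotomy x 0 with hx | hx | hx
  · rw [oddRoot, Real.sign_of_neg hx, abs_mul, abs_of_nonneg (Real.rpow_nonneg (abs_nonneg x) _)]
    simp
  · simp only [oddRoot, hx, Real.sign_zero, zero_mul, abs_zero, Real.zero_rpow hp.ne']
  · rw [oddRoot, Real.sign_of_pos hx, one_mul, abs_of_nonneg (Real.rpow_nonneg (abs_nonneg x) _)]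

/-- The odd root is the inverse of a strictly monotone continuous bijection. -/
theorem continuous_oddRoot : Continuous (oddRoot n) := by
  have hodd : Odd (2 * n + 1) := ⟨n, rfl⟩
  have hmono : Monotone (oddRoot n) := fun x y hxy => by
    rw [← hodd.strictMono_pow.le_iff_le (a := oddRoot n x), oddRoot_pow, oddRoot_pow]; exact hxy
  refine hmono.continuous_of_surjective fun y => ⟨y ^ (2 * n + 1), ?_⟩
  exact hodd.strictMono_pow.injective (oddRoot_pow n _)

theorem continuous_centeredRoot : Continuous (centeredRoot n) :=
  (continuous_oddRoot n).comp (by fun_prop)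

theorem kernelK_eq (θ : ℝ) (t u : unitInterval) :
    kernelK n θ t u = 1 + θ * (centeredRoot n t * centeredRoot n u) := by
  rw [kernelK, oddRoot_mul]; rfl

theorem rootMax_pos : 0 < rootMax n := by unfold rootMax; positivity

theorem thetaMax_pos : 0 < thetaMax n := by unfold thetaMax; positivity

theorem rootMax_sq_mul_thetaMax : rootMax n ^ 2 * thetaMax n = 1 := by
  rw [rootMax, thetaMax, ← Real.rpow_natCast, ← Real.rpow_mul (by norm_num), mul_comm (1 / _),
    Real.rpow_mul (by norm_num), ← Real.mul_rpow (by positivity) (by norm_num)]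
  norm_num

theorem abs_centeredRoot (t : unitInterval) :
    |centeredRoot n t| = |(t : ℝ) - 1 / 2| ^ (1 / (2 * n + 1 : ℝ)) := abs_oddRoot n _

theorem abs_centeredRoot_le (t : unitInterval) : |centeredRoot n t| ≤ rootMax n := by
  rw [abs_centeredRoot, rootMax]
  refine Real.rpow_le_rpow (abs_nonneg _) ?_ (by positivity)
  have h0 := t.2.1
  have h1 := t.2.2
  rw [abs_le]; constructor <;> linarith

theorem abs_centeredRoot_lt {t : unitInterval} (h0 : t ≠ 0) (h1 : t ≠ 1) :
    |centeredRoot n t| < rootMax n := by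
  rw [abs_centeredRoot, rootMax]
  refine Real.rpow_lt_rpow (abs_nonneg _) ?_ (by positivity)
  have h0' := unitInterval.pos_iff_ne_zero.2 h0
  have h1' := unitInterval.lt_one_iff_ne_one.2 h1
  rw [abs_lt]
  have h2 : (0 : ℝ) < t := h0'
  have h3 : (t : ℝ) < 1 := h1'
  constructor <;> linarith

theorem centeredRoot_symm (t : unitInterval) :
    centeredRoot n (unitInterval.symm t) = -centeredRoot n t := by
  rw [centeredRoot, centeredRoot, ← oddRoot_neg, unitInterval.coe_symm_eq]
  congr 1; ring

theorem abs_mul_rootMax_sq_lt {θ : ℝ} (h1 : -thetaMax n < θ) (h2 : θ < thetaMax n) :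
    |θ| * rootMax n ^ 2 < 1 := by
  rw [← rootMax_sq_mul_thetaMax n, mul_comm]
  exact mul_lt_mul_of_pos_left (abs_lt.2 ⟨h1, h2⟩) (pow_pos (rootMax_pos n) 2)

end Root

/-! ### Moments of the odd root -/

section Moments

variable (n : ℕ)

theorem integral_centeredRoot_pow_even (i : ℕ) :
    ∫ t, centeredRoot n t ^ (2 * i) = alphaEven n i := by
  set p : ℝ := 2 * i / (2 * n + 1) with hp
  have hp0 : 0 ≤ p := by positivity
  have h1 : ∀ t : unitInterval, centeredRoot n t ^ (2 * i) = |(t : ℝ) - 1 / 2| ^ p := by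
    intro t
    rw [← Even.pow_abs ⟨i, by ring⟩, abs_centeredRoot, ← Real.rpow_natCast,
      ← Real.rpow_mul (abs_nonneg _)]
    congr 1
    push_cast; rw [hp]; ring
  have h2 : ∫ t : unitInterval, |(t : ℝ) - 1 / 2| ^ p = ∫ x in (0 : ℝ)..1, |x - 1 / 2| ^ p := by
    rw [intervalIntegral.integral_of_le zero_le_one, ← integral_Icc_eq_integral_Ioc]
    exact unitInterval.measurePreserving_coe.integral_comp
      unitInterval.measurableEmbedding_coe (fun x : ℝ => |x - 1 / 2| ^ p)
  have hc : Continuous fun x : ℝ => |x| ^ p := continuous_abs.rpow_const fun _ => Or.inr hp0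
  have h3 : ∫ x in (0 : ℝ)..(1 / 2), |x| ^ p = (1 / 2) ^ (p + 1) / (p + 1) := by
    have : ∫ x in (0 : ℝ)..(1 / 2), |x| ^ p = ∫ x in (0 : ℝ)..(1 / 2), x ^ p := by
      refine intervalIntegral.integral_congr fun x hx => ?_
      rw [Set.uIcc_of_le (by norm_num)] at hx
      simp only [abs_of_nonneg hx.1]
    rw [this, integral_rpow (Or.inl (by linarith)), Real.zero_rpow (by positivity), sub_zero]
  have h4 : ∫ x in (-(1 / 2) : ℝ)..0, |x| ^ p = (1 / 2) ^ (p + 1) / (p + 1) := by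
    have := intervalIntegral.integral_comp_neg (fun x : ℝ => |x| ^ p) (a := 0) (b := 1 / 2)
    simp only [abs_neg, neg_zero] at this
    rw [← this, h3]
  have h5 : ∫ x in (0 : ℝ)..1, |x - 1 / 2| ^ p = (1 / 2) ^ p / (p + 1) := by
    rw [intervalIntegral.integral_comp_sub_right (fun x : ℝ => |x| ^ p) (1 / 2)]
    norm_num only
    rw [← intervalIntegral.integral_add_adjacent_intervals (hc.intervalIntegrable _ 0)
      (hc.intervalIntegrable 0 _)]
    norm_num only at h3 h4 ⊢
    rw [h3, h4, Real.rpow_add (by norm_num), Real.rpow_one]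
    ring
  simp only [h1]
  rw [h2, h5, alphaEven, ← hp]
  have h6 : (2 * n + 1 : ℝ) ≠ 0 := by positivity
  have h7 : p + 1 = (2 * n + 2 * i + 1) / (2 * n + 1) := by rw [hp]; field_simp; ring
  rw [h7]
  field_simp

theorem integral_centeredRoot_pow_odd (i : ℕ) :
    ∫ t, centeredRoot n t ^ (2 * i + 1) = 0 := by
  have h := unitInterval.measurePreserving_symm.integral_comp
    unitInterval.symmMeasurableEquiv.measurableEmbedding
    (fun t => centeredRoot n t ^ (2 * i + 1))
  simp only [centeredRoot_symm, Odd.neg_pow ⟨i, rfl⟩, integral_neg] at h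
  linarith

theorem alphaEven_pos (i : ℕ) : 0 < alphaEven n i := by unfold alphaEven; positivity

theorem betaOdd_pos {s i : ℕ} (hi : i < s) : 0 < betaOdd s n i :=
  mul_pos (Nat.cast_pos.2 (Nat.choose_pos (by omega))) (alphaEven_pos n _)

theorem integrable_of_continuous {f : unitInterval → ℝ} (hf : Continuous f) : Integrable f :=
  hf.integrable_of_hasCompactSupport (HasCompactSupport.of_compactSpace f)

end Moments

/-! ### The scalar equation for translation-invariant boundary laws -/

section ScalarEquation

/-- `∫ a^j (1 + c a)^k` with `a = centeredRoot n`; for `j = 0, 1` this is the total mass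
and the unnormalized mean of `a` for a spin with density proportional to `(1 + c a)^k`. -/
def powerMoment (n k j : ℕ) (c : ℝ) : ℝ :=
  ∫ t, centeredRoot n t ^ j * (1 + c * centeredRoot n t) ^ k

/-- The polynomial whose positive roots are the squares of the nonzero solutions `c` of
`θ ∫ a (1 + c a)^{2s} = c ∫ (1 + c a)^{2s}`. -/
def boundaryPoly (s n : ℕ) (θ y : ℝ) : ℝ :=
  ∑ i ∈ Finset.range s, betaOdd s n i * (thetaOdd s n i - θ) * y ^ i + alphaEven n s * y ^ s

variable {s n : ℕ}

theorem powerMoment_eq_sum (k j : ℕ) (c : ℝ) : powerMoment n k j c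
    = ∑ m ∈ Finset.range (k + 1), k.choose m * c ^ m * ∫ t, centeredRoot n t ^ (m + j) := by
  have hc := continuous_centeredRoot n
  have h : ∀ t, centeredRoot n t ^ j * (1 + c * centeredRoot n t) ^ k
      = ∑ m ∈ Finset.range (k + 1), k.choose m * c ^ m * centeredRoot n t ^ (m + j) := by
    intro t
    rw [add_comm, add_pow, Finset.mul_sum]
    refine Finset.sum_congr rfl fun m _ => ?_
    ring
  simp only [powerMoment, h]
  rw [integral_finsetSum _ fun m _ => integrable_of_continuous (by fun_prop)]
  refine Finset.sum_congr rfl fun m _ => ?_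
  rw [integral_const_mul]

theorem sum_range_two_mul_add_one (g : ℕ → ℝ) (s : ℕ) : ∑ m ∈ Finset.range (2 * s + 1), g m
    = ∑ i ∈ Finset.range (s + 1), g (2 * i) + ∑ i ∈ Finset.range s, g (2 * i + 1) := by
  induction s with
  | zero => simp
  | succ s ih =>
    rw [show 2 * (s + 1) + 1 = 2 * s + 1 + 1 + 1 by ring, Finset.sum_range_succ,
      Finset.sum_range_succ, ih, Finset.sum_range_succ _ (s + 1), Finset.sum_range_succ _ s,
      show 2 * (s + 1) = 2 * s + 1 + 1 by ring, Finset.sum_range_succ _ s]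
    ring

theorem powerMoment_zero (c : ℝ) : powerMoment n (2 * s) 0 c
    = ∑ i ∈ Finset.range (s + 1), ((2 * s).choose (2 * i) : ℝ) * alphaEven n i * (c ^ 2) ^ i := by
  rw [powerMoment_eq_sum, sum_range_two_mul_add_one]
  simp only [add_zero, integral_centeredRoot_pow_odd, integral_centeredRoot_pow_even, mul_zero,
    Finset.sum_const_zero]
  refine Finset.sum_congr rfl fun i _ => ?_
  rw [pow_mul]; ring

theorem powerMoment_one (c : ℝ) : powerMoment n (2 * s) 1 c
    = c * ∑ i ∈ Finset.range s, betaOdd s n i * (c ^ 2) ^ i := by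
  rw [powerMoment_eq_sum, sum_range_two_mul_add_one, Finset.mul_sum]
  simp only [integral_centeredRoot_pow_odd, mul_zero, Finset.sum_const_zero, zero_add]
  refine Finset.sum_congr rfl fun i _ => ?_
  rw [show 2 * i + 1 + 1 = 2 * (i + 1) by ring, integral_centeredRoot_pow_even, betaOdd, pow_succ,
    pow_mul]
  ring

theorem betaOdd_mul_thetaOdd {i : ℕ} (hi : i < s) :
    betaOdd s n i * thetaOdd s n i = ((2 * s).choose (2 * i) : ℝ) * alphaEven n i := by
  have h1 : ((2 * s).choose (2 * i + 1) : ℝ) * (2 * i + 1)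
      = ((2 * s).choose (2 * i) : ℝ) * (2 * s - 2 * i) := by
    have := Nat.choose_succ_right_eq (2 * s) (2 * i)
    have h2 : ((2 * s - 2 * i : ℕ) : ℝ) = 2 * s - 2 * i := by
      rw [Nat.cast_sub (by omega)]; push_cast; ring
    rw [← h2]
    exact_mod_cast this
  have h3 : (1 / 2 : ℝ) ^ (2 * i / (2 * n + 1) : ℝ)
      = (1 / 2 : ℝ) ^ (2 * ((i + 1 : ℕ) : ℝ) / (2 * n + 1) : ℝ) * thetaMax n := by
    have h4 : (2 * ((i + 1 : ℕ) : ℝ) / (2 * n + 1) : ℝ)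
        = 2 * i / (2 * n + 1) + 1 / (2 * n + 1) * (2 : ℕ) := by push_cast; ring
    rw [h4, Real.rpow_add (by norm_num), Real.rpow_mul (by norm_num), Real.rpow_natCast, mul_assoc]
    have := rootMax_sq_mul_thetaMax n
    rw [rootMax] at this
    rw [this, mul_one]
  have hsi : (2 * s - 2 * i : ℝ) ≠ 0 := by
    have : (i : ℝ) < s := by exact_mod_cast hi
    intro h; linarith
  have hsi' : (s - i : ℝ) ≠ 0 := fun h => hsi (by linear_combination 2 * h)
  have hn1 : (2 * n + 2 * i + 1 : ℝ) ≠ 0 := by positivity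
  have hn2 : (2 * n + 2 * ((i + 1 : ℕ) : ℝ) + 1 : ℝ) ≠ 0 := by positivity
  have hn3 : (2 * n + 2 * i + 3 : ℝ) = 2 * n + 2 * ((i + 1 : ℕ) : ℝ) + 1 := by push_cast; ring
  rw [betaOdd, thetaOdd, alphaEven, alphaEven, h3, hn3]
  calc _ = (((2 * s).choose (2 * i + 1) : ℝ) * (2 * i + 1)) * ((2 * n + 1) *
        ((1 / 2 : ℝ) ^ (2 * ((i + 1 : ℕ) : ℝ) / (2 * n + 1) : ℝ) * thetaMax n)) /
          ((2 * s - 2 * i) * (2 * n + 2 * i + 1)) := by field_simp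
    _ = _ := by rw [h1]; field_simp

/-- Up to the factor `c`, the equation `θ ∫ a (1 + c a)^{2s} = c ∫ (1 + c a)^{2s}` is polynomial in
`c²`. -/
theorem mul_powerMoment_sub (θ c : ℝ) :
    c * powerMoment n (2 * s) 0 c - θ * powerMoment n (2 * s) 1 c
      = c * boundaryPoly s n θ (c ^ 2) := by
  rw [powerMoment_zero, powerMoment_one, boundaryPoly, Finset.sum_range_succ, Nat.choose_self]
  have h : ∑ i ∈ Finset.range s, betaOdd s n i * (thetaOdd s n i - θ) * (c ^ 2) ^ i
      = ∑ i ∈ Finset.range s, ((2 * s).choose (2 * i) : ℝ) * alphaEven n i * (c ^ 2) ^ i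
        - θ * ∑ i ∈ Finset.range s, betaOdd s n i * (c ^ 2) ^ i := by
    rw [Finset.mul_sum, ← Finset.sum_sub_distrib]
    refine Finset.sum_congr rfl fun i hi => ?_
    rw [← betaOdd_mul_thetaOdd (Finset.mem_range.1 hi)]
    ring
  rw [h, Nat.cast_one]
  ring

theorem thetaOdd_mono {i j : ℕ} (hij : i ≤ j) (hj : j < s) : thetaOdd s n i ≤ thetaOdd s n j := by
  have hi' : (i : ℝ) ≤ j := by exact_mod_cast hij
  have hj' : (j : ℝ) < s := by exact_mod_cast hj
  have hn : (0 : ℝ) ≤ n := Nat.cast_nonneg n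
  have hi0 : (0 : ℝ) ≤ i := Nat.cast_nonneg i
  have h : ∀ l : ℕ, thetaOdd s n l = thetaMax n *
      (((2 * l + 1) / (2 * n + 2 * l + 1)) * ((2 * n + 2 * l + 3) / (2 * s - 2 * l))) := by
    intro l; rw [thetaOdd, div_mul_div_comm, mul_div_assoc']
    congr 1 <;> ring
  rw [h, h]
  refine mul_le_mul_of_nonneg_left ?_ (thetaMax_pos n).le
  have hsj : (0 : ℝ) < 2 * s - 2 * j := by linarith
  refine mul_le_mul ?_ ?_ ?_ (by positivity)
  · rw [div_le_div_iff₀ (by positivity) (by positivity)]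
    nlinarith
  · exact div_le_div₀ (by positivity) (by linarith) hsj (by linarith)
  · exact div_nonneg (by positivity) (by linarith)

theorem thetaOdd_zero_pos (hs : 1 ≤ s) : 0 < thetaOdd s n 0 := by
  have h : (0 : ℝ) < s := by exact_mod_cast hs
  have := thetaMax_pos n
  unfold thetaOdd
  norm_num
  positivity

theorem continuous_boundaryPoly (θ : ℝ) : Continuous (boundaryPoly s n θ) := by
  unfold boundaryPoly; fun_prop

theorem boundaryPoly_pos_of_le {θ y : ℝ} (hθ : θ ≤ thetaOdd s n 0) (hy : 0 < y) :
    0 < boundaryPoly s n θ y := by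
  refine add_pos_of_nonneg_of_pos (Finset.sum_nonneg fun i hi => ?_)
    (mul_pos (alphaEven_pos n s) (pow_pos hy s))
  rw [Finset.mem_range] at hi
  exact mul_nonneg (mul_nonneg (betaOdd_pos n hi).le
    (sub_nonneg.2 (hθ.trans (thetaOdd_mono (Nat.zero_le i) hi)))) (pow_pos hy i).le

/-- At `c = 1 / max a` the difference `∫ (1 + c a)^k - c ∫ a (1 + c a)^k` is the integral of
`(1 - c a) (1 + c a)^k`, which is nonnegative and vanishes only at the ends of `[0, 1]`. -/
theorem boundaryPoly_thetaMax_pos {θ : ℝ} (hθ : θ ≤ thetaMax n) :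
    0 < boundaryPoly s n θ (thetaMax n) := by
  have hr := rootMax_pos n
  set c := (rootMax n)⁻¹ with hc
  have hc0 : 0 < c := inv_pos.2 hr
  have hc2 : c ^ 2 = thetaMax n := by
    rw [hc, inv_pow, inv_eq_of_mul_eq_one_right (rootMax_sq_mul_thetaMax n)]
  have hcont := continuous_centeredRoot n
  have hca : ∀ t, |c * centeredRoot n t| ≤ 1 := fun t => by
    rw [abs_mul, abs_of_pos hc0, hc, inv_mul_le_iff₀ hr, mul_one]
    exact abs_centeredRoot_le n t
  have hint : powerMoment n (2 * s) 0 c - c * powerMoment n (2 * s) 1 c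
      = ∫ t, (1 - c * centeredRoot n t) * (1 + c * centeredRoot n t) ^ (2 * s) := by
    rw [powerMoment, powerMoment, ← integral_const_mul, ← integral_sub
      (integrable_of_continuous (by fun_prop)) (integrable_of_continuous (by fun_prop))]
    refine integral_congr_ae (.of_forall fun t => ?_)
    simp only
    ring
  have hpos : 0 < ∫ t, (1 - c * centeredRoot n t) * (1 + c * centeredRoot n t) ^ (2 * s) := by
    have hfc : Continuous fun t =>
        (1 - c * centeredRoot n t) * (1 + c * centeredRoot n t) ^ (2 * s) := by fun_prop
    rw [integral_pos_iff_support_of_nonneg (fun t => mul_nonneg (sub_nonneg.2 (abs_le.1 (hca t)).2)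
      (Even.pow_nonneg ⟨s, by ring⟩ _)) (integrable_of_continuous hfc)]
    have hsub : ({0, 1} : Set unitInterval)ᶜ ⊆ Function.support fun t =>
        (1 - c * centeredRoot n t) * (1 + c * centeredRoot n t) ^ (2 * s) := by
      intro t ht
      simp only [Set.mem_compl_iff, Set.mem_insert_iff, Set.mem_singleton_iff, not_or] at ht
      have hlt : |c * centeredRoot n t| < 1 := by
        rw [abs_mul, abs_of_pos hc0, hc, inv_mul_lt_iff₀ hr, mul_one]
        exact abs_centeredRoot_lt n ht.1 ht.2
      exact mul_ne_zero (by linarith [(abs_lt.1 hlt).2])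
        (pow_ne_zero _ (by linarith [(abs_lt.1 hlt).1]))
    refine lt_of_lt_of_le ?_ (measure_mono hsub)
    rw [prob_compl_eq_one_sub (Set.toFinite _).measurableSet, (Set.toFinite _).measure_zero]
    simp
  have h1 := mul_powerMoment_sub (s := s) (n := n) (thetaMax n) c
  have h2 : thetaMax n = c * c := by rw [← hc2, sq]
  have h3 : 0 < boundaryPoly s n (thetaMax n) (thetaMax n) := by
    rw [← hint] at hpos
    rw [hc2] at h1
    have : c * (powerMoment n (2 * s) 0 c - c * powerMoment n (2 * s) 1 c)
        = c * boundaryPoly s n (thetaMax n) (thetaMax n) := by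
      rw [← h1]; linear_combination powerMoment n (2 * s) 1 c * h2
    rwa [mul_left_cancel₀ hc0.ne' this] at hpos
  refine h3.trans_le (add_le_add_left (Finset.sum_le_sum fun i hi => ?_) _)
  exact mul_le_mul_of_nonneg_right (mul_le_mul_of_nonneg_left (by linarith)
    (betaOdd_pos n (Finset.mem_range.1 hi)).le) (pow_pos (thetaMax_pos n) i).le

theorem thetaMax_lt_threshold (hs : 1 ≤ s) : thetaMax n < threshold s n := by
  have hpow : ∀ i : ℕ, (2 : ℝ) ^ (2 * i / (2 * n + 1) : ℝ) = thetaMax n ^ i := by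
    intro i
    rw [thetaMax, ← Real.rpow_natCast, ← Real.rpow_mul (by norm_num),
      show (4 : ℝ) = 2 ^ (2 : ℝ) by norm_num, ← Real.rpow_mul (by norm_num)]
    congr 1; ring
  have hden : 0 < ∑ i ∈ Finset.range s, (2 : ℝ) ^ (2 * i / (2 * n + 1) : ℝ) * betaOdd s n i :=
    Finset.sum_pos (fun i hi => mul_pos (by positivity) (betaOdd_pos n (Finset.mem_range.1 hi)))
      (Finset.nonempty_range_iff.2 (by omega))
  rw [threshold, lt_div_iff₀ hden, ← sub_pos]
  have h := boundaryPoly_thetaMax_pos (s := s) (n := n) le_rfl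
  rw [boundaryPoly] at h
  refine lt_of_lt_of_eq h (Eq.symm ?_)
  simp only [hpow]
  rw [add_sub_right_comm, Finset.mul_sum, ← Finset.sum_sub_distrib]
  congr 1
  exact Finset.sum_congr rfl fun i _ => by ring

/-- The coefficients of `boundaryPoly` change their sign once, at an index `j`; so
`y ↦ boundaryPoly y / y ^ j` is strictly increasing. -/
theorem boundaryPoly_pos_of_root_lt {θ y z : ℝ} (hs : 1 ≤ s) (hθ : thetaOdd s n 0 < θ) (hy : 0 < y)
    (hyz : y < z) (hFy : boundaryPoly s n θ y = 0) : 0 < boundaryPoly s n θ z := by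
  classical
  have hz : 0 < z := hy.trans hyz
  have hex : ∃ j, j = s ∨ (j < s ∧ θ ≤ thetaOdd s n j) := ⟨s, Or.inl rfl⟩
  set j := Nat.find hex with hj
  have hjspec := Nat.find_spec hex
  rw [← hj] at hjspec
  have hj_min : ∀ i, i < j → thetaOdd s n i < θ := by
    intro i hi
    have := Nat.find_min hex hi
    simp only [not_or, not_and, not_le] at this
    exact this.2 (by omega)
  have hj0 : 0 < j := by
    rcases Nat.eq_zero_or_pos j with h | h
    · rw [h] at hjspec
      rcases hjspec with h' | h'
      · omega
      · linarith [h'.2]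
    · exact h
  set q := z / y with hq
  have hq1 : 1 < q := (one_lt_div hy).2 hyz
  have hzq : z = q * y := by rw [hq]; field_simp
  have key : boundaryPoly s n θ z = boundaryPoly s n θ z - q ^ j * boundaryPoly s n θ y := by
    rw [hFy]; ring
  rw [key]
  have hexp : boundaryPoly s n θ z - q ^ j * boundaryPoly s n θ y
      = ∑ i ∈ Finset.range s, betaOdd s n i * y ^ i * ((thetaOdd s n i - θ) * (q ^ i - q ^ j))
        + alphaEven n s * y ^ s * (q ^ s - q ^ j) := by
    simp only [boundaryPoly, hzq, mul_pow]
    rw [mul_add, Finset.mul_sum, add_sub_add_comm, ← Finset.sum_sub_distrib]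
    congr 1
    · exact Finset.sum_congr rfl fun i _ => by ring
    · ring
  rw [hexp]
  refine add_pos_of_pos_of_nonneg (Finset.sum_pos' (fun i hi => ?_)
    ⟨0, Finset.mem_range.2 (by omega), ?_⟩) ?_
  · rw [Finset.mem_range] at hi
    refine mul_nonneg (mul_nonneg (betaOdd_pos n hi).le (pow_pos hy i).le) ?_
    rcases lt_or_ge i j with h | h
    · exact mul_nonneg_of_nonpos_of_nonpos (sub_nonpos.2 (hj_min i h).le)
        (sub_nonpos.2 (pow_le_pow_right₀ hq1.le h.le))
    · refine mul_nonneg (sub_nonneg.2 ?_) (sub_nonneg.2 (pow_le_pow_right₀ hq1.le h))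
      rcases hjspec with h' | h'
      · omega
      · exact h'.2.trans (thetaOdd_mono h hi)
  · refine mul_pos (mul_pos (betaOdd_pos n (by omega)) (pow_pos hy 0)) ?_
    exact mul_pos_of_neg_of_neg (sub_neg.2 hθ) (sub_neg.2 (pow_lt_pow_right₀ hq1 hj0))
  · refine mul_nonneg (mul_nonneg (alphaEven_pos n s).le (pow_pos hy s).le) (sub_nonneg.2 ?_)
    refine pow_le_pow_right₀ hq1.le ?_
    rcases hjspec with h' | h'
    · exact h'.le
    · exact h'.1.le

theorem existsUnique_boundaryPoly_root {θ : ℝ} (hs : 1 ≤ s) (hθ : thetaOdd s n 0 < θ)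
    (hθ' : θ < thetaMax n) : ∃! y, 0 < y ∧ boundaryPoly s n θ y = 0 := by
  have h0 : boundaryPoly s n θ 0 < 0 := by
    obtain ⟨s, rfl⟩ : ∃ r, s = r + 1 := ⟨s - 1, by omega⟩
    rw [boundaryPoly, Finset.sum_range_succ']
    simp only [ne_eq, Nat.add_eq_zero_iff, one_ne_zero, and_false, not_false_eq_true, zero_pow,
      mul_zero, Finset.sum_const_zero, pow_zero, mul_one, zero_add, add_zero]
    exact mul_neg_of_pos_of_neg (betaOdd_pos n (by omega)) (sub_neg.2 hθ)
  obtain ⟨y, hy, hFy⟩ := intermediate_value_Ioo (thetaMax_pos n).le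
    (continuous_boundaryPoly θ).continuousOn ⟨h0, boundaryPoly_thetaMax_pos (s := s) hθ'.le⟩
  refine ⟨y, ⟨hy.1, hFy⟩, ?_⟩
  rintro z ⟨hz, hFz⟩
  rcases lt_trichotomy y z with h | h | h
  · exact absurd hFz (boundaryPoly_pos_of_root_lt hs hθ hy.1 h hFy).ne'
  · exact h.symm
  · exact absurd hFy (boundaryPoly_pos_of_root_lt hs hθ hz h hFz).ne'

/-- The solutions `c` of `θ ∫ a (1 + c a)^{2s} = c ∫ (1 + c a)^{2s}`, where `a = centeredRoot n`. -/
def boundarySolutions (s n : ℕ) (θ : ℝ) : Set ℝ :=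
  {c | θ * powerMoment n (2 * s) 1 c = c * powerMoment n (2 * s) 0 c}

theorem mem_boundarySolutions {θ c : ℝ} :
    c ∈ boundarySolutions s n θ ↔ c = 0 ∨ boundaryPoly s n θ (c ^ 2) = 0 := by
  rw [← mul_eq_zero, ← mul_powerMoment_sub, sub_eq_zero]
  exact eq_comm

theorem boundarySolutions_eq_singleton {θ : ℝ} (hθ : θ ≤ thetaOdd s n 0) :
    boundarySolutions s n θ = {0} := by
  ext c
  rw [mem_boundarySolutions, Set.mem_singleton_iff, or_iff_left_iff_imp]
  intro h
  by_contra hc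
  exact (boundaryPoly_pos_of_le hθ (by positivity)).ne' h

theorem encard_boundarySolutions {θ : ℝ} (hs : 1 ≤ s) (hθ : thetaOdd s n 0 < θ)
    (hθ' : θ < thetaMax n) : (boundarySolutions s n θ).encard = 3 := by
  obtain ⟨y, ⟨hy, hFy⟩, huniq⟩ := existsUnique_boundaryPoly_root hs hθ hθ'
  have hr : 0 < √y := Real.sqrt_pos.2 hy
  have h : boundarySolutions s n θ = {0, √y, -√y} := by
    ext c
    rw [mem_boundarySolutions]
    simp only [Set.mem_insert_iff, Set.mem_singleton_iff]
    constructor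
    · rintro (h | h)
      · exact Or.inl h
      · by_cases hc : c = 0
        · exact Or.inl hc
        · right
          rw [← sq_eq_sq_iff_eq_or_eq_neg, Real.sq_sqrt hy.le]
          exact huniq _ ⟨by positivity, h⟩
    · rintro (h | h | h)
      · exact Or.inl h
      · right; rw [h, Real.sq_sqrt hy.le, hFy]
      · right; rw [h, neg_sq, Real.sq_sqrt hy.le, hFy]
  rw [h, Set.encard_insert_of_notMem, Set.encard_pair]
  · norm_num
  · intro h'; linarith
  · simp only [Set.mem_insert_iff, Set.mem_singleton_iff, not_or]
    exact ⟨hr.ne, by intro h'; linarith⟩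

end ScalarEquation

/-! ### The finite-volume distributions as weights on balls -/

section GibbsMeasures

open scoped ENNReal

/-- The kernel `K` as a function with values in `[0, ∞]`. -/
def kernelENN (n : ℕ) (θ : ℝ) (t u : unitInterval) : ℝ≥0∞ := ENNReal.ofReal (kernelK n θ t u)

/-- The boundary law `(1 + c a)^k` with `a = centeredRoot n`, as a function with values in
`[0, ∞]`. -/
def boundaryLaw (n k : ℕ) (c : ℝ) (t : unitInterval) : ℝ≥0∞ :=
  ENNReal.ofReal ((1 + c * centeredRoot n t) ^ k)

variable {V : Type*} {G : SimpleGraph V} {x₀ : V} {k s n : ℕ} {J β θ : ℝ}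

theorem continuous_kernelK : Continuous fun p : unitInterval × unitInterval =>
    kernelK n θ p.1 p.2 := by
  have := continuous_centeredRoot n
  simp only [kernelK_eq]
  fun_prop

theorem measurable_kernelENN : Measurable (Function.uncurry (kernelENN n θ)) :=
  continuous_kernelK.measurable.ennreal_ofReal

theorem abs_kernelK_sub_one_le (t u : unitInterval) :
    |kernelK n θ t u - 1| ≤ |θ| * rootMax n ^ 2 := by
  rw [kernelK_eq, add_sub_cancel_left, abs_mul, abs_mul, sq]
  exact mul_le_mul_of_nonneg_left (mul_le_mul (abs_centeredRoot_le n t) (abs_centeredRoot_le n u)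
    (abs_nonneg _) (rootMax_pos n).le) (abs_nonneg θ)

theorem le_kernelENN (t u : unitInterval) :
    ENNReal.ofReal (1 - |θ| * rootMax n ^ 2) ≤ kernelENN n θ t u :=
  ENNReal.ofReal_le_ofReal (by
    linarith [(abs_le.1 (abs_kernelK_sub_one_le (n := n) (θ := θ) t u)).1])

theorem kernelENN_le (t u : unitInterval) :
    kernelENN n θ t u ≤ ENNReal.ofReal (1 + |θ| * rootMax n ^ 2) :=
  ENNReal.ofReal_le_ofReal (by
    linarith [(abs_le.1 (abs_kernelK_sub_one_le (n := n) (θ := θ) t u)).2])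

theorem kernelK_pos (hθ : |θ| * rootMax n ^ 2 < 1) (t u : unitInterval) : 0 < kernelK n θ t u := by
  linarith [(abs_le.1 (abs_kernelK_sub_one_le (n := n) (θ := θ) t u)).1]

theorem sum_filter_restrict {M : Type*} [AddCommMonoid M] (B : Finset V) (P : V → Prop)
    [DecidablePred P] (f : V → M) :
    ∑ y ∈ Finset.univ.filter (fun y : B => P (y : V)), f y = ∑ y ∈ B.filter P, f y := by
  rw [Finset.sum_filter, Finset.sum_filter, ← Finset.sum_coe_sort B]

theorem measurable_gibbsWeight {h : V → unitInterval → ℝ} (m : ℕ)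
    (hh : ∀ x, x ≠ x₀ → Measurable (h x)) :
    Measurable (gibbsWeight G x₀ J β (interaction n J β θ) h (m + 1)) := by
  have hlog : Measurable fun p : unitInterval × unitInterval => interaction n J β θ p.1 p.2 :=
    (Real.measurable_log.comp continuous_kernelK.measurable).const_mul _
  unfold gibbsWeight hamiltonian
  refine Real.measurable_exp.comp ((((Finset.measurable_fun_sum _ fun x _ =>
    Finset.measurable_fun_sum _ fun y _ => ?_).const_mul _).const_mul _).add
    (Finset.measurable_fun_sum _ fun x hx => ?_))
  · exact hlog.comp (f := fun σ : treeBall G x₀ (m + 1) → unitInterval => (σ x, σ y))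
      ((measurable_pi_apply x).prodMk (measurable_pi_apply y))
  · rw [Finset.mem_filter] at hx
    refine (hh x ?_).comp (measurable_pi_apply x)
    intro h0
    simp [h0] at hx

variable [G.LocallyFinite]

/-- Since `-β H` is the sum of `ln K` over the edges, `exp (-β H)` is a product of values of `K`. -/
theorem IsCayleyTree.ofReal_gibbsWeight (hG : IsCayleyTree G k) (hJ : J ≠ 0) (hβ : 0 < β)
    (hθ : |θ| * rootMax n ^ 2 < 1) {h : V → unitInterval → ℝ} {g : unitInterval → ℝ}
    (hg : ∀ x, x ≠ x₀ → h x = g) (m : ℕ) (ω : V → unitInterval) :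
    ENNReal.ofReal (gibbsWeight G x₀ J β (interaction n J β θ) h (m + 1)
        ((treeBall G x₀ (m + 1)).restrict ω))
      = treeWeight G x₀ (kernelENN n θ) (fun t => ENNReal.ofReal (Real.exp (g t))) m ω := by
  classical
  have h1 : -β * hamiltonian G x₀ J (interaction n J β θ) (m + 1)
      ((treeBall G x₀ (m + 1)).restrict ω)
      = ∑ x ∈ treeBall G x₀ m, ∑ y ∈ successors G x₀ x, Real.log (kernelK n θ (ω x) (ω y)) := by
    have h2 : ∀ x : V, ∑ y ∈ Finset.univ.filter
          (fun y : treeBall G x₀ (m + 1) => IsSuccessor G x₀ x (y : V)),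
          interaction n J β θ (ω x) (ω y)
        = ∑ y ∈ (treeBall G x₀ (m + 1)).filter (fun y => IsSuccessor G x₀ x y),
          interaction n J β θ (ω x) (ω y) := fun x =>
      sum_filter_restrict _ (fun y => IsSuccessor G x₀ x y)
        (fun y => interaction n J β θ (ω x) (ω y))
    have h3 : ∑ x : treeBall G x₀ (m + 1), ∑ y ∈ Finset.univ.filter
          (fun y : treeBall G x₀ (m + 1) => IsSuccessor G x₀ (x : V) (y : V)),
          interaction n J β θ (ω x) (ω y)
        = ∑ x ∈ treeBall G x₀ m, ∑ y ∈ successors G x₀ x, interaction n J β θ (ω x) (ω y) := by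
      simp only [h2]
      rw [Finset.sum_coe_sort (treeBall G x₀ (m + 1)) (fun x =>
        ∑ y ∈ (treeBall G x₀ (m + 1)).filter (fun y => IsSuccessor G x₀ x y),
          interaction n J β θ (ω x) (ω y)), hG.treeBall_succ,
        Finset.sum_union (hG.disjoint_treeBall_treeSphere m), ← hG.treeBall_succ]
      have h4 : ∑ x ∈ treeSphere G x₀ (m + 1),
          ∑ y ∈ (treeBall G x₀ (m + 1)).filter (fun y => IsSuccessor G x₀ x y),
            interaction n J β θ (ω x) (ω y) = 0 := by
        refine Finset.sum_eq_zero fun x hx => ?_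
        rw [Finset.filter_false_of_mem, Finset.sum_empty]
        intro y hy hxy
        rw [mem_treeBall hG, hxy.2, hG.mem_treeSphere.1 hx] at hy
        omega
      rw [h4, add_zero]
      refine Finset.sum_congr rfl fun x hx => Finset.sum_congr ?_ fun _ _ => rfl
      ext y
      rw [Finset.mem_filter, mem_successors, and_iff_right_iff_imp]
      exact fun hy => hG.successor_mem_treeBall hx (mem_successors.2 hy)
    have h5 : hamiltonian G x₀ J (interaction n J β θ) (m + 1)
        ((treeBall G x₀ (m + 1)).restrict ω)
        = -J * ∑ x ∈ treeBall G x₀ m, ∑ y ∈ successors G x₀ x,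
          interaction n J β θ (ω x) (ω y) := by
      rw [← h3]; rfl
    rw [h5]
    simp only [interaction, ← Finset.mul_sum]
    have := hβ.ne'
    field_simp
  have h6 : ∑ x ∈ Finset.univ.filter (fun x : treeBall G x₀ (m + 1) => G.dist x₀ (x : V) = m + 1),
      h x ((treeBall G x₀ (m + 1)).restrict ω x) = ∑ x ∈ treeSphere G x₀ (m + 1), g (ω x) := by
    have := sum_filter_restrict (treeBall G x₀ (m + 1)) (fun x => G.dist x₀ x = m + 1)
      (fun x => h x (ω x))
    refine Eq.trans ?_ (this.trans ?_)
    · rfl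
    · refine Finset.sum_congr ?_ fun x hx => by rw [hg x (hG.ne_root hx)]
      rw [treeSphere]
  rw [gibbsWeight, h1]
  have h7 : Real.exp (∑ x ∈ treeBall G x₀ m, ∑ y ∈ successors G x₀ x,
        Real.log (kernelK n θ (ω x) (ω y)) + ∑ x ∈ treeSphere G x₀ (m + 1), g (ω x))
      = (∏ x ∈ treeBall G x₀ m, ∏ y ∈ successors G x₀ x, kernelK n θ (ω x) (ω y)) *
        ∏ x ∈ treeSphere G x₀ (m + 1), Real.exp (g (ω x)) := by
    rw [Real.exp_add, Real.exp_sum, Real.exp_sum]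
    congr 1
    refine Finset.prod_congr rfl fun x _ => ?_
    rw [Real.exp_sum]
    exact Finset.prod_congr rfl fun y _ => Real.exp_log (kernelK_pos hθ _ _)
  have hK0 : ∀ x y : V, 0 ≤ kernelK n θ (ω x) (ω y) := fun x y => (kernelK_pos hθ _ _).le
  have h8 : Real.exp (∑ x ∈ treeBall G x₀ m, ∑ y ∈ successors G x₀ x,
        Real.log (kernelK n θ (ω x) (ω y)) + ∑ x ∈ Finset.univ.filter
          (fun x : treeBall G x₀ (m + 1) => G.dist x₀ (x : V) = m + 1),
          h x ((treeBall G x₀ (m + 1)).restrict ω x))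
      = (∏ x ∈ treeBall G x₀ m, ∏ y ∈ successors G x₀ x, kernelK n θ (ω x) (ω y)) *
        ∏ x ∈ treeSphere G x₀ (m + 1), Real.exp (g (ω x)) := by rw [h6, h7]
  refine Eq.trans (congrArg ENNReal.ofReal (Eq.trans ?_ h8)) ?_
  · congr
  · rw [ENNReal.ofReal_mul (Finset.prod_nonneg fun x _ => Finset.prod_nonneg fun y _ => hK0 x y),
      ENNReal.ofReal_prod_of_nonneg fun x _ => Finset.prod_nonneg fun y _ => hK0 x y,
      ENNReal.ofReal_prod_of_nonneg fun x _ => (Real.exp_pos _).le, treeWeight, edgeWeight]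
    congr 1
    refine Finset.prod_congr rfl fun x _ => ?_
    rw [ENNReal.ofReal_prod_of_nonneg fun y _ => hK0 x y]
    rfl

theorem IsCayleyTree.finiteVolumeGibbs_eq (hG : IsCayleyTree G k) (hJ : J ≠ 0) (hβ : 0 < β)
    (hθ : |θ| * rootMax n ^ 2 < 1) {h : V → unitInterval → ℝ} {g : unitInterval → ℝ}
    (hg : ∀ x, x ≠ x₀ → h x = g) (hgm : Measurable g) (m : ℕ) :
    finiteVolumeGibbs G x₀ J β (interaction n J β θ) h (m + 1)
      = ENNReal.ofReal (partitionFunction G x₀ J β (interaction n J β θ) h (m + 1))⁻¹ •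
        (treeMeasure G x₀ (kernelENN n θ) (fun t => ENNReal.ofReal (Real.exp (g t))) volume m).map
          (treeBall G x₀ (m + 1)).restrict := by
  have hm : Measurable fun σ => ENNReal.ofReal
      (gibbsWeight G x₀ J β (interaction n J β θ) h (m + 1) σ) :=
    (measurable_gibbsWeight m fun x hx => by rw [hg x hx]; exact hgm).ennreal_ofReal
  have h1 := map_restrict_withDensity_infinitePi volume (treeBall G x₀ (m + 1)) hm
  simp only [hG.ofReal_gibbsWeight hJ hβ hθ hg m] at h1
  rw [treeMeasure, show treeWeight G x₀ (kernelENN n θ) (fun t => ENNReal.ofReal (Real.exp (g t))) m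
    = fun ω => treeWeight G x₀ (kernelENN n θ) (fun t => ENNReal.ofReal (Real.exp (g t))) m ω
    from rfl, h1, ← withDensity_smul _ hm, finiteVolumeGibbs]
  congr 1
  funext σ
  have hZ : 0 ≤ (partitionFunction G x₀ J β (interaction n J β θ) h (m + 1))⁻¹ :=
    inv_nonneg.2 (integral_nonneg fun σ => (Real.exp_pos _).le)
  rw [ENNReal.ofReal_mul hZ]
  rfl

theorem IsCayleyTree.partitionFunction_eq (hG : IsCayleyTree G k) (hJ : J ≠ 0) (hβ : 0 < β)
    (hθ : |θ| * rootMax n ^ 2 < 1) {h : V → unitInterval → ℝ} {g : unitInterval → ℝ}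
    (hg : ∀ x, x ≠ x₀ → h x = g) (hgm : Measurable g) (m : ℕ) :
    partitionFunction G x₀ J β (interaction n J β θ) h (m + 1)
      = (treeMeasure G x₀ (kernelENN n θ) (fun t => ENNReal.ofReal (Real.exp (g t))) volume m
          Set.univ).toReal := by
  have hm := measurable_gibbsWeight (G := G) (x₀ := x₀) (J := J) (β := β) (n := n) (θ := θ)
    (h := h) m fun x hx => by rw [hg x hx]; exact hgm
  have h0 : 0 ≤ᵐ[volume] gibbsWeight G x₀ J β (interaction n J β θ) h (m + 1) :=
    .of_forall fun σ => (Real.exp_pos _).le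
  rw [partitionFunction, integral_eq_lintegral_of_nonneg_ae h0 hm.aestronglyMeasurable, treeMeasure,
    withDensity_apply _ MeasurableSet.univ, Measure.restrict_univ]
  congr 1
  have h1 := lintegral_restrict_infinitePi (μ := fun _ : V => (volume : Measure unitInterval))
    (s := treeBall G x₀ (m + 1)) hm.ennreal_ofReal
  simp only [hG.ofReal_gibbsWeight hJ hβ hθ hg m] at h1
  exact h1.symm

/-- Translation-invariant Gibbs measures in terms of the boundary factor `exp h`; the value of `h`
at the root does not enter, because the balls have positive radius. -/
theorem IsCayleyTree.isTranslationInvariantGibbs_iff (hG : IsCayleyTree G k) (hJ : J ≠ 0)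
    (hβ : 0 < β) (hθ : |θ| * rootMax n ^ 2 < 1) (μ : Measure (V → unitInterval)) :
    IsTranslationInvariantGibbs G x₀ J β (interaction n J β θ) μ ↔
      ∃ g : unitInterval → ℝ, Measurable g ∧ IsTreeGibbs G x₀ (kernelENN n θ)
        (fun t => ENNReal.ofReal (Real.exp (g t))) volume μ := by
  constructor
  · rintro ⟨h, hconst, hμ, hm, hmarg⟩
    obtain ⟨y, hy⟩ := hG.treeSphere_one_nonempty (x₀ := x₀)
    have hy0 := hG.ne_root hy
    refine ⟨h y, hm y hy0, hμ, fun m => ⟨ENNReal.ofReal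
      (partitionFunction G x₀ J β (interaction n J β θ) h (m + 1))⁻¹, ?_⟩⟩
    rw [hmarg (m + 1) (by omega)]
    exact hG.finiteVolumeGibbs_eq hJ hβ hθ (fun x hx => hconst x y hx hy0) (hm y hy0) m
  · rintro ⟨g, hgm, hμ, hmarg⟩
    refine ⟨fun _ => g, fun _ _ _ _ => rfl, hμ, fun _ _ => hgm, fun n' hn' => ?_⟩
    obtain ⟨m, rfl⟩ : ∃ m, n' = m + 1 := ⟨n' - 1, by omega⟩
    obtain ⟨c, hc⟩ := hmarg m
    have h1 := mul_univ_eq_one_of_map_restrict hc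
    rw [hc, hG.finiteVolumeGibbs_eq hJ hβ hθ (fun _ _ => rfl) hgm,
      hG.partitionFunction_eq hJ hβ hθ (fun _ _ => rfl) hgm]
    congr 1
    rw [mul_comm] at h1
    rw [← ENNReal.toReal_inv, ← ENNReal.eq_inv_of_mul_eq_one_left (mul_comm c _ ▸ h1)]
    rw [mul_comm] at h1
    exact (ENNReal.ofReal_toReal (ne_top_of_mul_eq_one h1)).symm

end GibbsMeasures

/-! ### Boundary laws of translation-invariant Gibbs measures -/

section BoundaryLaws

open scoped ENNReal

variable {V : Type*} {G : SimpleGraph V} [G.LocallyFinite] {x₀ : V} {k s n : ℕ} {J β θ : ℝ}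

/-- Only the mean of `f` and its mean against `a = centeredRoot n` enter in `∫ K(t, u) f(u) du`. -/
theorem kernelIntegral_kernelENN (hθ : |θ| * rootMax n ^ 2 < 1) {f : unitInterval → ℝ}
    (hf : Integrable f) (hf0 : ∀ u, 0 ≤ f u) (t : unitInterval) :
    kernelIntegral (kernelENN n θ) (fun u => ENNReal.ofReal (f u)) volume t
      = ENNReal.ofReal ((∫ u, f u) + θ * centeredRoot n t * ∫ u, centeredRoot n u * f u) ∧
    0 ≤ (∫ u, f u) + θ * centeredRoot n t * ∫ u, centeredRoot n u * f u := by
  have haf : Integrable fun u => centeredRoot n u * f u :=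
    hf.bdd_mul (continuous_centeredRoot n).aestronglyMeasurable
      (.of_forall fun u => abs_centeredRoot_le n u)
  have h1 : ∀ u, kernelK n θ t u * f u
      = f u + θ * centeredRoot n t * (centeredRoot n u * f u) := fun u => by
    rw [kernelK_eq]; ring
  have hint : Integrable fun u => kernelK n θ t u * f u := by
    simp only [h1]; exact hf.add (haf.const_mul _)
  have h2 : ∫ u, kernelK n θ t u * f u
      = (∫ u, f u) + θ * centeredRoot n t * ∫ u, centeredRoot n u * f u := by
    simp only [h1]
    rw [integral_add hf (haf.const_mul _), integral_const_mul]
  have h0 : ∀ u, 0 ≤ kernelK n θ t u * f u := fun u =>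
    mul_nonneg (kernelK_pos hθ t u).le (hf0 u)
  rw [← h2]
  refine ⟨?_, integral_nonneg h0⟩
  rw [ofReal_integral_eq_lintegral_ofReal hint (.of_forall h0)]
  exact lintegral_congr fun u => (ENNReal.ofReal_mul (kernelK_pos hθ t u).le).symm

theorem measurable_boundaryLaw (c : ℝ) : Measurable (boundaryLaw n k c) := by
  have := continuous_centeredRoot n
  exact (Continuous.measurable (by fun_prop)).ennreal_ofReal

theorem continuous_one_add_pow (c : ℝ) :
    Continuous fun t => (1 + c * centeredRoot n t) ^ k := by
  have := continuous_centeredRoot n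
  fun_prop

theorem one_add_pow_nonneg (c : ℝ) (t : unitInterval) :
    0 ≤ (1 + c * centeredRoot n t) ^ (2 * s) := Even.pow_nonneg ⟨s, by ring⟩ _

theorem powerMoment_zero_pos (c : ℝ) : 0 < powerMoment n (2 * s) 0 c := by
  rw [powerMoment_zero, Finset.sum_range_succ']
  refine add_pos_of_nonneg_of_pos (Finset.sum_nonneg fun i _ => ?_) ?_
  · exact mul_nonneg (mul_nonneg (Nat.cast_nonneg _) (alphaEven_pos n _).le) (by positivity)
  · simpa using alphaEven_pos n 0

/-- Solutions of the scalar equation satisfy `|c| max |a| < 1`, because `∫ a f ≤ max |a| ∫ f` for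
`f = (1 + c a)^{2s} ≥ 0`. -/
theorem one_add_pos_of_mem_boundarySolutions (hθ : |θ| * rootMax n ^ 2 < 1) {c : ℝ}
    (hc : c ∈ boundarySolutions s n θ) (t : unitInterval) : 0 < 1 + c * centeredRoot n t := by
  have hr := rootMax_pos n
  have hcont := continuous_one_add_pow (n := n) (k := 2 * s) c
  have ha := continuous_centeredRoot n
  have hN : powerMoment n (2 * s) 0 c = ∫ t, (1 + c * centeredRoot n t) ^ (2 * s) := by
    simp [powerMoment]
  have hN0 := powerMoment_zero_pos (n := n) (s := s) c
  have hD : |powerMoment n (2 * s) 1 c| ≤ rootMax n * powerMoment n (2 * s) 0 c := by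
    rw [powerMoment, hN, ← integral_const_mul]
    refine (abs_integral_le_integral_abs).trans (integral_mono
      (integrable_of_continuous (by fun_prop)) (integrable_of_continuous (by fun_prop)) fun t => ?_)
    simp only [pow_one, abs_mul, abs_of_nonneg (one_add_pow_nonneg c t)]
    exact mul_le_mul_of_nonneg_right (abs_centeredRoot_le n t) (one_add_pow_nonneg c t)
  have h1 : |c| * powerMoment n (2 * s) 0 c = |θ| * |powerMoment n (2 * s) 1 c| := by
    rw [← abs_mul, show θ * _ = _ from hc, abs_mul, abs_of_pos hN0]
  have h2 : |c| ≤ |θ| * rootMax n := by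
    refine le_of_mul_le_mul_right ?_ hN0
    rw [h1, mul_assoc]
    exact mul_le_mul_of_nonneg_left hD (abs_nonneg θ)
  have h3 : |c * centeredRoot n t| < 1 := by
    rw [abs_mul]
    calc |c| * |centeredRoot n t| ≤ (|θ| * rootMax n) * rootMax n :=
          mul_le_mul h2 (abs_centeredRoot_le n t) (abs_nonneg _) (by positivity)
      _ = |θ| * rootMax n ^ 2 := by ring
      _ < 1 := hθ
  linarith [(abs_lt.1 h3).1]

theorem boundaryLaw_ne_zero (hθ : |θ| * rootMax n ^ 2 < 1) {c : ℝ}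
    (hc : c ∈ boundarySolutions s n θ) (t : unitInterval) : boundaryLaw n k c t ≠ 0 :=
  (ENNReal.ofReal_pos.2 (pow_pos (one_add_pos_of_mem_boundarySolutions hθ hc t) k)).ne'

theorem boundaryLaw_eq_exp (hθ : |θ| * rootMax n ^ 2 < 1) {c : ℝ}
    (hc : c ∈ boundarySolutions s n θ) : boundaryLaw n (2 * s) c
      = fun t => ENNReal.ofReal (Real.exp ((2 * s : ℕ) * Real.log (1 + c * centeredRoot n t))) := by
  funext t
  rw [Real.exp_nat_mul, Real.exp_log (one_add_pos_of_mem_boundarySolutions hθ hc t)]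
  rfl

theorem kernelIntegral_boundaryLaw (hθ : |θ| * rootMax n ^ 2 < 1) {c : ℝ}
    (hc : c ∈ boundarySolutions s n θ) (t : unitInterval) :
    kernelIntegral (kernelENN n θ) (boundaryLaw n (2 * s) c) volume t ^ (2 * s)
      = ENNReal.ofReal (powerMoment n (2 * s) 0 c) ^ (2 * s) * boundaryLaw n (2 * s) c t := by
  have h1 := (kernelIntegral_kernelENN hθ
    (integrable_of_continuous (continuous_one_add_pow (n := n) (k := 2 * s) c))
    (one_add_pow_nonneg c) t).1
  have hpos := one_add_pos_of_mem_boundarySolutions hθ hc t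
  have h2 : (∫ u, (1 + c * centeredRoot n u) ^ (2 * s)) + θ * centeredRoot n t *
      ∫ u, centeredRoot n u * (1 + c * centeredRoot n u) ^ (2 * s)
      = powerMoment n (2 * s) 0 c * (1 + c * centeredRoot n t) := by
    have hc' : θ * powerMoment n (2 * s) 1 c = c * powerMoment n (2 * s) 0 c := hc
    simp only [powerMoment, pow_zero, one_mul, pow_one] at hc' ⊢
    linear_combination centeredRoot n t * hc'
  rw [h2, ENNReal.ofReal_mul (powerMoment_zero_pos c).le] at h1
  refine (congrArg (· ^ (2 * s)) h1).trans ?_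
  simp only [mul_pow, boundaryLaw, ENNReal.ofReal_pow hpos.le]

theorem IsCayleyTree.exists_isTreeGibbs_boundaryLaw (hG : IsCayleyTree G (2 * s))
    (hθ : |θ| * rootMax n ^ 2 < 1) {c : ℝ} (hc : c ∈ boundarySolutions s n θ) :
    ∃ μ, IsTreeGibbs G x₀ (kernelENN n θ) (boundaryLaw n (2 * s) c) volume μ := by
  have hF := measurable_boundaryLaw (n := n) (k := 2 * s) c
  have hFi : ∫⁻ u, boundaryLaw n (2 * s) c u ≠ ∞ := by
    have hi := integrable_of_continuous (continuous_one_add_pow (n := n) (k := 2 * s) c)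
    have := ofReal_integral_eq_lintegral_ofReal hi (.of_forall (one_add_pow_nonneg c))
    exact this ▸ ENNReal.ofReal_ne_top
  have hδ : ENNReal.ofReal (1 - |θ| * rootMax n ^ 2) ≠ 0 :=
    (ENNReal.ofReal_pos.2 (by linarith)).ne'
  refine hG.exists_isTreeGibbs measurable_kernelENN hF
    (.of_forall fun t => kernelIntegral_boundaryLaw hθ hc t) (fun m => ?_) fun m =>
    treeMeasure_univ_ne_top volume hF ENNReal.ofReal_ne_top kernelENN_le hFi m
  obtain ⟨C, hC, hle⟩ := exists_le_treeMeasure_univ (G := G) (x₀ := x₀) volume hF hδ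
    le_kernelENN m
  intro h0
  rw [h0, nonpos_iff_eq_zero] at hle
  exact mul_ne_zero hC (pow_ne_zero _
    (lintegral_ne_zero_of_forall_ne_zero hF (boundaryLaw_ne_zero hθ hc))) hle

/-- A proportionality of nonnegative functions, passed from `[0, ∞]` to the real numbers. -/
theorem ae_eq_toReal_mul {f g : unitInterval → ℝ} (hf : ∀ t, 0 ≤ f t) (hg : ∀ t, 0 ≤ g t)
    {a : ℝ≥0∞} (h : (fun t => ENNReal.ofReal (f t)) =ᵐ[volume] fun t => a * ENNReal.ofReal (g t)) :
    f =ᵐ[volume] fun t => a.toReal * g t := by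
  filter_upwards [h] with t ht
  have := congrArg ENNReal.toReal ht
  rwa [ENNReal.toReal_mul, ENNReal.toReal_ofReal (hf t), ENNReal.toReal_ofReal (hg t)] at this

/-- A boundary factor `f` reproduces itself, so `f` is proportional to `(A + θ B a)^k` with
`A = ∫ f` and `B = ∫ a f`, and `c = θ B / A` solves the scalar equation. -/
theorem IsTreeGibbs.exists_boundaryLaw (hG : IsCayleyTree G (2 * s))
    (hθ : |θ| * rootMax n ^ 2 < 1) {g : unitInterval → ℝ} (hg : Measurable g)
    {μ : Measure (V → unitInterval)} (hμ : IsTreeGibbs G x₀ (kernelENN n θ)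
      (fun t => ENNReal.ofReal (Real.exp (g t))) volume μ) :
    ∃ c ∈ boundarySolutions s n θ,
      IsTreeGibbs G x₀ (kernelENN n θ) (boundaryLaw n (2 * s) c) volume μ := by
  set f : unitInterval → ℝ := fun t => Real.exp (g t) with hf
  have hfm : Measurable f := Real.measurable_exp.comp hg
  have hf0 : ∀ t, 0 ≤ f t := fun t => (Real.exp_pos _).le
  have hδ : ENNReal.ofReal (1 - |θ| * rootMax n ^ 2) ≠ 0 :=
    (ENNReal.ofReal_pos.2 (by linarith)).ne'
  have hF0 : ∀ t, ENNReal.ofReal (f t) ≠ 0 := fun t =>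
    (ENNReal.ofReal_pos.2 (Real.exp_pos _)).ne'
  obtain ⟨a, ha0, ha, hae⟩ := hμ.ae_eq_kernelIntegral_pow hG measurable_kernelENN hδ
    ENNReal.ofReal_ne_top le_kernelENN kernelENN_le hfm.ennreal_ofReal hF0
  have hFi := hμ.lintegral_ne_top hG hfm.ennreal_ofReal hδ le_kernelENN
  have hFz : ∫⁻ t, ENNReal.ofReal (f t) ≠ 0 :=
    lintegral_ne_zero_of_forall_ne_zero hfm.ennreal_ofReal hF0
  have hfi : Integrable f := ⟨hfm.aestronglyMeasurable, by
    rw [hasFiniteIntegral_iff_ofReal (.of_forall hf0)]; exact hFi.lt_top⟩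
  set A := ∫ u, f u with hA
  set B := ∫ u, centeredRoot n u * f u with hB
  have hApos : 0 < A := by
    rw [hA, integral_eq_lintegral_of_nonneg_ae (.of_forall hf0) hfm.aestronglyMeasurable]
    exact ENNReal.toReal_pos hFz hFi
  set c := θ * B / A with hc
  have hcA : c * A = θ * B := by rw [hc]; field_simp
  have hpow : ∀ t, kernelIntegral (kernelENN n θ) (fun u => ENNReal.ofReal (f u)) volume t
      ^ (2 * s) = ENNReal.ofReal (A ^ (2 * s)) * boundaryLaw n (2 * s) c t := by
    intro t
    obtain ⟨h1, h2⟩ := kernelIntegral_kernelENN hθ hfi hf0 t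
    rw [h1, ← ENNReal.ofReal_pow h2, boundaryLaw, ← ENNReal.ofReal_mul (by positivity), ← mul_pow]
    congr 2
    linear_combination (-centeredRoot n t) * hcA
  have hae' : (fun t => ENNReal.ofReal (f t)) =ᵐ[volume]
      fun t => (a * ENNReal.ofReal (A ^ (2 * s))) * boundaryLaw n (2 * s) c t := by
    filter_upwards [hae] with t ht
    rw [ht, hpow, mul_assoc]
  refine ⟨c, ?_, hμ.congr measurable_kernelENN (measurable_boundaryLaw c) hae'⟩
  have hreal := ae_eq_toReal_mul hf0 (one_add_pow_nonneg c) hae'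
  set p := (a * ENNReal.ofReal (A ^ (2 * s))).toReal
  have hAp : A = p * powerMoment n (2 * s) 0 c := by
    rw [hA, integral_congr_ae hreal, integral_const_mul]
    simp [powerMoment]
  have hBp : B = p * powerMoment n (2 * s) 1 c := by
    rw [hB, powerMoment, ← integral_const_mul]
    refine integral_congr_ae ?_
    filter_upwards [hreal] with t ht
    rw [ht, pow_one]; ring
  have hp : p ≠ 0 := by
    intro h; rw [h, zero_mul] at hAp; exact hApos.ne' hAp
  refine mul_left_cancel₀ hp ?_
  linear_combination c * hAp - θ * hBp - hcA

theorem IsTreeGibbs.boundarySolution_unique (hG : IsCayleyTree G (2 * s))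
    (hθ : |θ| * rootMax n ^ 2 < 1) {c c' : ℝ} (hc : c ∈ boundarySolutions s n θ)
    (hc' : c' ∈ boundarySolutions s n θ) {μ : Measure (V → unitInterval)}
    (hμ : IsTreeGibbs G x₀ (kernelENN n θ) (boundaryLaw n (2 * s) c) volume μ)
    (hμ' : IsTreeGibbs G x₀ (kernelENN n θ) (boundaryLaw n (2 * s) c') volume μ) : c = c' := by
  have hδ : ENNReal.ofReal (1 - |θ| * rootMax n ^ 2) ≠ 0 :=
    (ENNReal.ofReal_pos.2 (by linarith)).ne'
  obtain ⟨a, -, -, hae⟩ := hμ.ae_eq_const_mul hG measurable_kernelENN hδ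
    ENNReal.ofReal_ne_top le_kernelENN kernelENN_le (measurable_boundaryLaw c)
    (boundaryLaw_ne_zero hθ hc) (measurable_boundaryLaw c') (boundaryLaw_ne_zero hθ hc') hμ'
  have hreal := ae_eq_toReal_mul (one_add_pow_nonneg c) (one_add_pow_nonneg c') hae
  have hj : ∀ j, powerMoment n (2 * s) j c = a.toReal * powerMoment n (2 * s) j c' := by
    intro j
    rw [powerMoment, powerMoment, ← integral_const_mul]
    refine integral_congr_ae ?_
    filter_upwards [hreal] with t ht
    rw [ht]; ring
  have h1 : θ * powerMoment n (2 * s) 1 c = c * powerMoment n (2 * s) 0 c := hc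
  have h2 : θ * powerMoment n (2 * s) 1 c' = c' * powerMoment n (2 * s) 0 c' := hc'
  refine mul_right_cancel₀ (powerMoment_zero_pos (n := n) (s := s) c).ne' ?_
  linear_combination -h1 + θ * hj 1 + a.toReal * h2 - c' * hj 0

/-- Translation-invariant Gibbs measures are in bijection with the solutions of the scalar
equation. -/
theorem IsCayleyTree.exists_injOn_image_eq (hG : IsCayleyTree G (2 * s)) (hJ : J ≠ 0) (hβ : 0 < β)
    (hθ : |θ| * rootMax n ^ 2 < 1) : ∃ M : ℝ → Measure (V → unitInterval),
      Set.InjOn M (boundarySolutions s n θ) ∧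
      {μ | IsTranslationInvariantGibbs G x₀ J β (interaction n J β θ) μ}
        = M '' boundarySolutions s n θ := by
  have hex : ∀ c, ∃ μ, c ∈ boundarySolutions s n θ →
      IsTreeGibbs G x₀ (kernelENN n θ) (boundaryLaw n (2 * s) c) volume μ := by
    intro c
    by_cases hc : c ∈ boundarySolutions s n θ
    · obtain ⟨μ, hμ⟩ := hG.exists_isTreeGibbs_boundaryLaw (x₀ := x₀) hθ hc
      exact ⟨μ, fun _ => hμ⟩
    · exact ⟨0, fun h => absurd h hc⟩
  choose M hM using hex
  refine ⟨M, fun c hc c' hc' h => ?_, Set.ext fun μ => ?_⟩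
  · exact (hM c hc).boundarySolution_unique hG hθ hc hc' (h ▸ hM c' hc')
  · rw [Set.mem_ofPred_eq, hG.isTranslationInvariantGibbs_iff hJ hβ hθ]
    constructor
    · rintro ⟨g, hg, hμ⟩
      obtain ⟨c, hc, hμc⟩ := hμ.exists_boundaryLaw hG hθ hg
      exact ⟨c, hc, hG.isTreeGibbs_unique (hM c hc) hμc⟩
    · rintro ⟨c, hc, rfl⟩
      refine ⟨fun t => (2 * s : ℕ) * Real.log (1 + c * centeredRoot n t), ?_, ?_⟩
      · exact (Real.measurable_log.comp (measurable_const.add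
          ((continuous_centeredRoot n).measurable.const_mul c))).const_mul _
      · rw [← boundaryLaw_eq_exp hθ hc]
        exact hM c hc

end BoundaryLaws

end

theorem theorem3p8 {V : Type*} (G : SimpleGraph V) [G.LocallyFinite] (s n : ℕ) (hs : 1 ≤ s)
    (hG : IsCayleyTree G (2 * s)) (x₀ : V) (J β : ℝ) (hJ : J ≠ 0) (hβ : 0 < β) (θ : ℝ) :
    (-thetaMax n < θ → θ < thetaMax n → θ ≤ thetaOdd s n 0 →
      ∃! μ : MeasureTheory.Measure (V → unitInterval),
        IsTranslationInvariantGibbs G x₀ J β (interaction n J β θ) μ) ∧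
    (threshold s n ≤ θ → θ ≤ thetaMax n →
      {μ : MeasureTheory.Measure (V → unitInterval) |
        IsTranslationInvariantGibbs G x₀ J β (interaction n J β θ) μ}.encard = 2) ∧
    (thetaOdd s n 0 < θ → θ < thetaMax n → θ < threshold s n →
      {μ : MeasureTheory.Measure (V → unitInterval) |
        IsTranslationInvariantGibbs G x₀ J β (interaction n J β θ) μ}.encard = 3) := by
  refine ⟨fun h1 h2 h3 => ?_, fun h1 h2 => ?_, fun h1 h2 _ => ?_⟩
  · obtain ⟨M, -, hM⟩ := hG.exists_injOn_image_eq (x₀ := x₀) (n := n) hJ hβ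
      (abs_mul_rootMax_sq_lt n h1 h2)
    rw [boundarySolutions_eq_singleton h3, Set.image_singleton] at hM
    exact ⟨M 0, Set.eq_singleton_iff_unique_mem.1 hM⟩
  -- No `θ` satisfies both hypotheses: the threshold exceeds the critical range of the parameter.
  · exact absurd (h1.trans h2) (not_le.2 (thetaMax_lt_threshold hs))
  · have h0 : -thetaMax n < θ := by
      linarith [thetaMax_pos n, thetaOdd_zero_pos (n := n) hs]
    obtain ⟨M, hinj, hM⟩ := hG.exists_injOn_image_eq (x₀ := x₀) (n := n) hJ hβ
      (abs_mul_rootMax_sq_lt n h0 h2)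
    rw [hM, hinj.encard_image, encard_boundarySolutions hs h1 h2]
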